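/- Rings are associative with $1\neq 0$ and modules are left modules. An element $x$ of the center of a ring $\Lambda$ is called regular on a $\Lambda$-module $M$ if it is a non-zero-divisor on $M$ and $xM\neq M$. We write $\Lambda_x$ and $M_x$ for the localizations at $\{1,x,x^2,\dots\}$. A $\Lambda$-module is strongly finitely presented if it has a projective resolution by finitely generated projective modules. For an integer $n\ge 0$, a $\Lambda$-module $T$ is $n$-tilting if (T1) $\operatorname{pd}_\Lambda T\le n$; (T2) $\operatorname{Ext}^i_\Lambda(T,T^{(\kappa)})=0$ for all $i\ge 1$ and all cardinals $\kappa$; (T3) for some $m\ge 0$ there is an exact sequence $0\to\Lambda\to T_0\to\cdots\to T_m\to 0$ in which every $T_i$ is a direct summand of a direct sum of copies of $T$. It is classical $n$-tilting if it is $n$-tilting and strongly finitely presented. A triple $(\Lambda,T,\Gamma)$, with $T$ a $\Lambda$-$\Gamma$-bimodule, is a classical $n$-tilting triple if $T$ is a classical $n$-tilting $\Lambda$-module and the ring homomorphism $\Gamma\to\operatorname{End}_\Lambda(T)^{\mathrm{op}}$ given by the right action of $\Gamma$ on $T$ is an isomorphism. **Theorem.** Let $\Lambda$ be a ring, $x$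 a central element of $\Lambda$, $T$ a strongly finitely presented $\Lambda$-module on which $x$ is regular, $\Gamma=\operatorname{End}_\Lambda(T)^{\mathrm{op}}$, and let $x_\bullet$ be the central element $t\mapsto xt$ of $\Gamma$. Let $n\ge 0$ be an integer. (i) If $(\Lambda,T,\Gamma)$ is a classical $n$-tilting triple, then so are $(\Lambda/x\Lambda,\ T/xT,\ \Gamma/x_\bullet\Gamma)$ and $(\Lambda_x,\ T_x,\ \Gamma_{x_\bullet})$, where the right actions on $T/xT$ and $T_x$ are those induced by the action of $\Gamma$ on $T$. In particular the canonical ring homomorphisms $\Gamma/x_\bullet\Gamma\to\operatorname{End}_{\Lambda/x\Lambda}(T/xT)^{\mathrm{op}}$ and $\Gamma_{x_\bullet}\to\operatorname{End}_{\Lambda_x}(T_x)^{\mathrm{op}}$ are isomorphisms. (ii) Suppose that the center of $\Lambda$ is noetherian, that $\Lambda$ is finitely generated as a module over its center, and that $x$ is also regular on $\Lambda$. If $T_x$ is a classical $n$-tilting $\Lambda_x$-module and $T/xT$ is a classical $n$-tilting $\Lambda/x\Lambda$-module, then $T$ is a classical $n$-tilting $\Lambda$-module. -/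

import Mathlib

open CategoryTheory

universe u

section Tilting

variable (Λ : Type u) [Ring Λ] (T : Type u) [AddCommGroup T] [Module Λ T]

/-- A module is strongly finitely presented if it has a degreewise finitely generated projective
resolution. -/
def StronglyFinitelyPresented : Prop :=
  ∃ P : ProjectiveResolution (ModuleCat.of Λ T), ∀ i : ℕ, Module.Finite Λ (P.complex.X i)

/-- `M` belongs to `Add T`: it is a direct summand of a direct sum of copies of `T`. -/
def IsInAdd (M : Type u) [AddCommGroup M] [Module Λ M] : Prop :=
  ∃ (ι : Type u) (i : M →ₗ[Λ] (ι →₀ T)) (p : (ι →₀ T) →ₗ[Λ] M), p ∘ₗ i = LinearMap.id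

/-- There is an exact sequence `0 → Λ → C 0 → ⋯ → C m → 0` with all `C i` in `Add T`. The sequence
is continued by zero modules after `C m`. -/
def HasAddCoresolution : Prop :=
  ∃ (m : ℕ) (C : ℕ → ModuleCat.{u} Λ) (ε : Λ →ₗ[Λ] C 0) (d : ∀ i : ℕ, C i →ₗ[Λ] C (i + 1)),
    Function.Injective ε ∧ Function.Exact ε (d 0) ∧
    (∀ i : ℕ, Function.Exact (d i) (d (i + 1))) ∧
    (∀ i : ℕ, i ≤ m → IsInAdd Λ T (C i)) ∧
    (∀ i : ℕ, m < i → Subsingleton (C i))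

/-- `n`-tilting modules (not necessarily finitely generated). -/
structure IsTilting (n : ℕ) : Prop where
  projectiveDimension_le : HasProjectiveDimensionLE (ModuleCat.of Λ T) n
  ext_eq_zero : ∀ (ι : Type u) (i : ℕ), 1 ≤ i →
    Subsingleton (Abelian.Ext.{u} (ModuleCat.of Λ T) (ModuleCat.of Λ (ι →₀ T)) i)
  coresolution : HasAddCoresolution Λ T

/-- Classical `n`-tilting modules. -/
structure IsClassicalTilting (n : ℕ) : Prop extends IsTilting Λ T n where
  stronglyFinitelyPresented : StronglyFinitelyPresented Λ T

/-- `(Λ, T, Γ)` is a classical `n`-tilting triple, where `T` is a `Λ`-`Γ`-bimodule and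
`φ : Γ → End_Λ(T)ᵒᵖ` is the ring homomorphism that gives the right action of `Γ` on `T`:
`T` is classical `n`-tilting and `φ` identifies `Γ` with `End_Λ(T)ᵒᵖ`. -/
structure IsClassicalTiltingTriple (n : ℕ) (Γ : Type u) [Ring Γ]
    (φ : Γ →+* (Module.End Λ T)ᵐᵒᵖ) : Prop where
  isClassicalTilting : IsClassicalTilting Λ T n
  bijective : Function.Bijective φ

end Tilting

section Central

variable {Λ : Type u} [Ring Λ] (x : Subring.center Λ)

theorem center_mul_comm (a : Λ) : a * (x : Λ) = (x : Λ) * a :=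
  Subring.mem_center_iff.mp x.2 a

theorem powers_center_mul_comm (s : Submonoid.powers (x : Λ)) (a : Λ) :
    (s : Λ) * a = a * (s : Λ) := by
  obtain ⟨k, hk⟩ := s.2
  simp only at hk
  rw [← hk]
  exact (Commute.pow_right (center_mul_comm x a) k).symm

/-- The powers of a central element form an Ore set. -/
instance powersCenterOreSet : OreLocalization.OreSet (Submonoid.powers (x : Λ)) where
  ore_right_cancel a b s h := ⟨s, by
    rw [powers_center_mul_comm, powers_center_mul_comm, h]⟩
  oreNum a _ := a
  oreDenom _ s := s
  ore_eq a s := powers_center_mul_comm x s a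

/-- The left ideal generated by a central element `x` is the two-sided ideal `xΛ`. -/
instance spanCenterIsTwoSided : (Ideal.span {(x : Λ)}).IsTwoSided where
  mul_mem_of_left {a} b ha := by
    obtain ⟨c, rfl⟩ := Ideal.mem_span_singleton'.mp ha
    exact Ideal.mem_span_singleton'.mpr ⟨c * b, by
      rw [mul_assoc, mul_assoc, center_mul_comm x b]⟩

/-- The ring `Λ/xΛ`. -/
abbrev RingMod : Type u := Λ ⧸ Ideal.span {(x : Λ)}

/-- The ring `Λ_x` of fractions with denominators in `{1, x, x², …}`. -/
abbrev RingLoc : Type u := OreLocalization (Submonoid.powers (x : Λ)) Λ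

variable (T : Type u) [AddCommGroup T] [Module Λ T]

/-- `x` is regular on `T`: it is a non-zero-divisor on `T` and `xT ≠ T`. -/
def IsRegularOn : Prop :=
  (∀ t : T, (x : Λ) • t = 0 → t = 0) ∧ ∃ t : T, ∀ t' : T, (x : Λ) • t' ≠ t

/-- The `Λ/xΛ`-module `T/xT`. -/
abbrev ModMod : Type u := T ⧸ (Ideal.span {(x : Λ)} • (⊤ : Submodule Λ T))

/-- The `Λ_x`-module `T_x`. -/
abbrev ModLoc : Type u := OreLocalization (Submonoid.powers (x : Λ)) T

/-- The ring `Γ = End_Λ(T)ᵒᵖ`. -/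
abbrev TiltedRing (Λ T : Type u) [Ring Λ] [AddCommGroup T] [Module Λ T] : Type u :=
  (Module.End Λ T)ᵐᵒᵖ

/-- Multiplication by `x` as an endomorphism of `T`. -/
def mulEnd : Module.End Λ T where
  toFun t := (x : Λ) • t
  map_add' a b := smul_add _ a b
  map_smul' r t := by
    simp only [RingHom.id_apply, smul_smul]
    rw [center_mul_comm x r]

/-- The central element `x_•` of `Γ` given by `t ↦ x t`. -/
def bullet : Subring.center (TiltedRing Λ T) :=
  ⟨MulOpposite.op (mulEnd x T), Subring.mem_center_iff.mpr fun g => by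
    apply MulOpposite.unop_injective
    ext t
    exact (g.unop.map_smul (x : Λ) t).symm⟩

variable {T}

/-- The endomorphism of `T/xT` induced by an endomorphism of `T`. -/
def endMod (f : Module.End Λ T) : Module.End (RingMod x) (ModMod x T) where
  toFun := Submodule.mapQ _ _ f
    (Submodule.smul_le.mpr fun r hr t _ => by
      rw [Submodule.mem_comap, map_smul]
      exact Submodule.smul_mem_smul hr trivial)
  map_add' := map_add _
  map_smul' r t := by
    obtain ⟨r, rfl⟩ := Ideal.Quotient.mk_surjective r
    obtain ⟨t, rfl⟩ := Submodule.Quotient.mk_surjective _ t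
    exact congrArg Submodule.Quotient.mk (f.map_smul r t)

/-- The endomorphism `t / s ↦ f(t) / s` of `T_x` induced by an endomorphism `f` of `T`. -/
def endLoc (f : Module.End Λ T) : Module.End (RingLoc x) (ModLoc x T) where
  toFun := OreLocalization.liftExpand (fun t s => OreLocalization.oreDiv (f t) s)
    fun t r s hs => by
      rw [f.map_smul]
      exact OreLocalization.expand (f t) s r hs
  map_add' a b := by
    induction a using OreLocalization.ind with | _ t s
    induction b using OreLocalization.ind with | _ t' s'
    obtain ⟨r₁, s₁, h, h'⟩ := OreLocalization.oreDivAddChar' t t' s s'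
    rw [h']
    simp only [OreLocalization.liftExpand_of]
    rw [OreLocalization.oreDiv_add_char (r := f t) (r' := f t') s s' r₁ s₁ h]
    rw [map_add, Submonoid.smul_def, f.map_smul, f.map_smul]
    rfl
  map_smul' a b := by
    induction a using OreLocalization.ind with | _ r s
    induction b using OreLocalization.ind with | _ t s'
    rw [OreLocalization.oreDiv_smul_oreDiv]
    simp only [OreLocalization.liftExpand_of, RingHom.id_apply]
    rw [OreLocalization.oreDiv_smul_oreDiv, f.map_smul]

theorem endLoc_apply (f : Module.End Λ T) (t : T) (s : Submonoid.powers (x : Λ)) :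
    endLoc x f (OreLocalization.oreDiv t s) = OreLocalization.oreDiv (f t) s := rfl

variable (T)

/-- The ring homomorphism `End_Λ(T)ᵒᵖ → End_{Λ/xΛ}(T/xT)ᵒᵖ`. -/
def tiltedRingToMod : TiltedRing Λ T →+* TiltedRing (RingMod x) (ModMod x T) where
  toFun f := MulOpposite.op (endMod x f.unop)
  map_one' := congrArg MulOpposite.op (LinearMap.ext fun t => by
    obtain ⟨t, rfl⟩ := Submodule.Quotient.mk_surjective _ t
    rfl)
  map_mul' f g := congrArg MulOpposite.op (LinearMap.ext fun t => by
    obtain ⟨t, rfl⟩ := Submodule.Quotient.mk_surjective _ t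
    rfl)
  map_zero' := congrArg MulOpposite.op (LinearMap.ext fun t => by
    obtain ⟨t, rfl⟩ := Submodule.Quotient.mk_surjective _ t
    rfl)
  map_add' f g := congrArg MulOpposite.op (LinearMap.ext fun t => by
    obtain ⟨t, rfl⟩ := Submodule.Quotient.mk_surjective _ t
    rfl)

/-- The ring homomorphism `End_Λ(T)ᵒᵖ → End_{Λ_x}(T_x)ᵒᵖ`. -/
def tiltedRingToLoc : TiltedRing Λ T →+* TiltedRing (RingLoc x) (ModLoc x T) where
  toFun f := MulOpposite.op (endLoc x f.unop)
  map_one' := by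
    apply MulOpposite.unop_injective
    ext a
    induction a using OreLocalization.ind with | _ t s
    rfl
  map_mul' f g := by
    apply MulOpposite.unop_injective
    ext a
    induction a using OreLocalization.ind with | _ t s
    rfl
  map_zero' := by
    apply MulOpposite.unop_injective
    ext a
    induction a using OreLocalization.ind with | _ t s
    exact OreLocalization.zero_oreDiv s
  map_add' f g := by
    apply MulOpposite.unop_injective
    ext a
    induction a using OreLocalization.ind with | _ t s
    exact OreLocalization.add_oreDiv.symm

/-- The canonical ring homomorphism `Γ/x_•Γ → End_{Λ/xΛ}(T/xT)ᵒᵖ`, induced by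
`f ↦ (t + xT ↦ f(t) + xT)`. -/
def tiltedRingModHom : RingMod (bullet x T) →+* TiltedRing (RingMod x) (ModMod x T) :=
  Ideal.Quotient.lift _ (tiltedRingToMod x T) fun f hf => by
    obtain ⟨g, rfl⟩ := Ideal.mem_span_singleton'.mp hf
    refine congrArg MulOpposite.op (LinearMap.ext fun t => ?_)
    obtain ⟨t, rfl⟩ := Submodule.Quotient.mk_surjective _ t
    exact (Submodule.Quotient.mk_eq_zero _).mpr
      (Submodule.smul_mem_smul (Ideal.mem_span_singleton_self (x : Λ)) trivial)

theorem tiltedRingToLoc_isUnit (s : Submonoid.powers (bullet x T : TiltedRing Λ T)) :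
    IsUnit (tiltedRingToLoc x T s) := by
  obtain ⟨k, hk⟩ := s.2
  simp only at hk
  rw [← hk, map_pow]
  refine IsUnit.pow k (IsUnit.op ((Module.End.isUnit_iff (endLoc x (mulEnd x T))).mpr ⟨?_, ?_⟩))
  · rw [injective_iff_map_eq_zero]
    intro a ha
    induction a using OreLocalization.ind with | _ t s
    change OreLocalization.oreDiv ((x : Λ) • t) s = 0 at ha
    rw [OreLocalization.zero_def, OreLocalization.oreDiv_eq_iff] at ha ⊢
    obtain ⟨u, v, h1, h2⟩ := ha
    rw [smul_zero] at h1
    refine ⟨u * ⟨x, Submonoid.mem_powers _⟩, v * x, ?_, ?_⟩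
    · rw [smul_zero, mul_smul, ← h1]
    · simp only [Submonoid.coe_mul, Submonoid.coe_one, mul_one] at h2 ⊢
      rw [mul_assoc, ← center_mul_comm x (s : Λ), ← mul_assoc, ← h2]
  · intro a
    induction a using OreLocalization.ind with | _ t s
    refine ⟨OreLocalization.oreDiv t (⟨x, Submonoid.mem_powers _⟩ * s), ?_⟩
    exact (OreLocalization.expand t s (x : Λ)
      (Submonoid.mul_mem _ (Submonoid.mem_powers _) s.2)).symm

/-- The canonical ring homomorphism `Γ_{x_•} → End_{Λ_x}(T_x)ᵒᵖ`, the unique extension of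
`f ↦ (t / s ↦ f(t) / s)`. -/
noncomputable def tiltedRingLocHom :
    RingLoc (bullet x T) →+* TiltedRing (RingLoc x) (ModLoc x T) :=
  OreLocalization.universalHom (tiltedRingToLoc x T)
    (IsUnit.liftRight ((tiltedRingToLoc x T).toMonoidHom.comp
      (Submonoid.powers (bullet x T : TiltedRing Λ T)).subtype) (tiltedRingToLoc_isUnit x T))
    fun _ => rfl

end Central

/-! ### Vanishing of Ext as a lifting and extension property. -/

section ExtVanishing

variable {R : Type u} [Ring R]

/-! Along `0 → K → P → M → 0` with `P` projective, all higher Ext of `M` into `N` vanish iff those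
of `K` do and every map `K → N` extends to `P` (`IsShortExact.extVanishes_iff`). Since `T` has a
finite resolution by finitely generated projectives, induction on its length turns (T1) and (T2)
into statements on extending maps out of finitely generated modules. One copy of `T` then suffices
in (T2).

Part (i). By (T3), `Λ` embeds into a module of `Add T`, so `x` is a non-zero-divisor on `Λ`, on the
syzygies of `T` and on the cokernels of the coresolution. Hence reduction modulo `x` keeps these
sequences exact, as localization always does. For a module `N` over the new ring, extension problems
into `N` are the same over both rings, so it remains to see that Ext of `T` into `T/xT` and `T_x`
vanishes over `Λ`. The first follows from `0 → T → T → T/xT → 0`; for the second, denominators of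
maps out of finitely generated modules are cleared. The same two arguments compute the endomorphism
rings.

Part (ii). The group Hom(K, N) of finitely generated modules is finitely generated over the center.
Let `H'` be the image of Hom(P, N) in `H = Hom(K, N)`. Solving extension problems over `Λ_x` shows
that `H/H'` is `x`-power torsion; solving them modulo `x` gives `H = H' + xH`. Together these force
`H' = H` (`exists_comp_eq_of_mod_loc`), which yields (T1) and (T2). For (T3), generators of Hom(M,
T) over the center form a left `Add T`-approximation `M → T^ι` with `ι` finite. It remains an
approximation modulo `x` and over `Λ_x`, where it is injective with a cokernel of shorter
coresolution (`HasFiniteAddCoresolution.of_isLeftAddApprox`, a Schanuel argument). Induction,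
starting with `M = Λ`, reaches a module whose reduction and localization lie in `Add`; there the
approximation splits on both sides, hence over `Λ`. -/

/-- The sequence `0 → A → B → C → 0` is exact. -/
structure IsShortExact {A B C : Type u} [AddCommGroup A] [Module R A] [AddCommGroup B] [Module R B]
    [AddCommGroup C] [Module R C] (i : A →ₗ[R] B) (p : B →ₗ[R] C) : Prop where
  injective : Function.Injective i
  exact : Function.Exact i p
  surjective : Function.Surjective p

/-- All `Extⁱ(M, N)` with `i ≥ 1` vanish. -/
def ExtVanishes (R : Type u) [Ring R] (M N : Type u) [AddCommGroup M] [Module R M]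
    [AddCommGroup N] [Module R N] : Prop :=
  ∀ i : ℕ, 1 ≤ i → Subsingleton (Abelian.Ext.{u} (ModuleCat.of R M) (ModuleCat.of R N) i)

variable {A B C M N : Type u} [AddCommGroup A] [Module R A] [AddCommGroup B] [Module R B]
  [AddCommGroup C] [Module R C] [AddCommGroup M] [Module R M] [AddCommGroup N] [Module R N]

namespace IsShortExact

variable {i : A →ₗ[R] B} {p : B →ₗ[R] C}

theorem comp_eq_zero (h : IsShortExact i p) : p ∘ₗ i = 0 := h.exact.linearMap_comp_eq_zero

theorem apply_apply (h : IsShortExact i p) (a : A) : p (i a) = 0 := h.exact.apply_apply_eq_zero a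

theorem of_injective (hi : Function.Injective i) : IsShortExact i (LinearMap.range i).mkQ :=
  ⟨hi, LinearMap.exact_iff.mpr (Submodule.ker_mkQ _), Submodule.mkQ_surjective _⟩

theorem of_surjective (hp : Function.Surjective p) :
    IsShortExact (LinearMap.ker p).subtype p :=
  ⟨Subtype.val_injective, LinearMap.exact_iff.mpr (Submodule.range_subtype _).symm, hp⟩

theorem exists_eq_comp_left (h : IsShortExact i p) (f : M →ₗ[R] B) (hf : ∀ m, p (f m) = 0) :
    ∃ g : M →ₗ[R] A, ∀ m, i (g m) = f m := by
  refine ⟨(LinearEquiv.ofInjective i h.injective).symm.toLinearMap ∘ₗ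
    f.codRestrict (LinearMap.range i) fun m => (h.exact (f m)).mp (hf m), fun m => ?_⟩
  exact congrArg Subtype.val ((LinearEquiv.ofInjective i h.injective).apply_symm_apply
    ⟨f m, (h.exact (f m)).mp (hf m)⟩)

theorem exists_eq_comp_right (h : IsShortExact i p) (f : B →ₗ[R] N) (hf : ∀ a, f (i a) = 0) :
    ∃ g : C →ₗ[R] N, ∀ b, g (p b) = f b := by
  have hk : LinearMap.ker p ≤ LinearMap.ker f := by
    intro b hb
    obtain ⟨a, rfl⟩ := (h.exact b).mp hb
    exact hf a
  refine ⟨(LinearMap.ker p).liftQ f hk ∘ₗ (p.quotKerEquivOfSurjective h.surjective).symm.toLinearMap,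
    fun b => ?_⟩
  have : (p.quotKerEquivOfSurjective h.surjective).symm (p b) = Submodule.Quotient.mk b := by
    rw [LinearEquiv.symm_apply_eq]; rfl
  simp [this]

theorem shortExact (h : IsShortExact i p) :
    (ShortComplex.mk (ModuleCat.ofHom i) (ModuleCat.ofHom p)
      (ModuleCat.hom_ext h.comp_eq_zero)).ShortExact where
  exact := (ShortComplex.ShortExact.moduleCat_exact_iff_function_exact _).mpr h.exact
  mono_f := (ModuleCat.mono_iff_injective _).mpr h.injective
  epi_g := (ModuleCat.epi_iff_surjective _).mpr h.surjective

theorem extend (h : IsShortExact i p) (hC : ExtVanishes R C N) (f : A →ₗ[R] N) :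
    ∃ g : B →ₗ[R] N, g ∘ₗ i = f := by
  have := hC 1 le_rfl
  obtain ⟨y, hy⟩ := Abelian.Ext.contravariant_sequence_exact₁ h.shortExact (ModuleCat.of R N)
    (Abelian.Ext.mk₀ (ModuleCat.ofHom f)) (n₁ := 1) rfl (Subsingleton.elim _ _)
  obtain ⟨g, rfl⟩ := Abelian.Ext.homEquiv₀.symm.surjective y
  refine ⟨g.hom, ?_⟩
  simp only [Abelian.Ext.homEquiv₀_symm_apply, Abelian.Ext.mk₀_comp_mk₀] at hy
  exact ModuleCat.hom_ext_iff.mp (Abelian.Ext.homEquiv₀.symm.injective hy)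

theorem lift_of_subsingleton (h : IsShortExact i p)
    (hA : Subsingleton (Abelian.Ext.{u} (ModuleCat.of R M) (ModuleCat.of R A) 1))
    (f : M →ₗ[R] C) : ∃ g : M →ₗ[R] B, p ∘ₗ g = f := by
  obtain ⟨y, hy⟩ := Abelian.Ext.covariant_sequence_exact₃ (ModuleCat.of R M) h.shortExact
    (Abelian.Ext.mk₀ (ModuleCat.ofHom f)) (n₁ := 1) rfl (Subsingleton.elim _ _)
  obtain ⟨g, rfl⟩ := Abelian.Ext.homEquiv₀.symm.surjective y
  refine ⟨g.hom, ?_⟩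
  simp only [Abelian.Ext.homEquiv₀_symm_apply, Abelian.Ext.mk₀_comp_mk₀] at hy
  exact ModuleCat.hom_ext_iff.mp (Abelian.Ext.homEquiv₀.symm.injective hy)

theorem lift (h : IsShortExact i p) (hA : ExtVanishes R M A) (f : M →ₗ[R] C) :
    ∃ g : M →ₗ[R] B, p ∘ₗ g = f :=
  h.lift_of_subsingleton (hA 1 le_rfl) f

theorem extVanishes_left (h : IsShortExact i p) (hB : ExtVanishes R B N)
    (hC : ExtVanishes R C N) : ExtVanishes R A N := by
  intro k hk
  have := hB k hk
  have := hC (1 + k) (by lia)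
  refine subsingleton_of_forall_eq 0 fun e => ?_
  obtain ⟨y, rfl⟩ := Abelian.Ext.contravariant_sequence_exact₁ h.shortExact (ModuleCat.of R N)
    e rfl (Subsingleton.elim _ _)
  rw [Subsingleton.elim y 0, Abelian.Ext.comp_zero]

theorem extVanishes_right (h : IsShortExact i p) (hA : ExtVanishes R A N)
    (hB : ExtVanishes R B N) (hext : ∀ f : A →ₗ[R] N, ∃ g : B →ₗ[R] N, g ∘ₗ i = f) :
    ExtVanishes R C N := by
  intro k hk
  have := hB k hk
  refine subsingleton_of_forall_eq 0 fun e => ?_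
  obtain ⟨k, rfl⟩ : ∃ l, k = 1 + l := ⟨k - 1, by lia⟩
  obtain ⟨y, rfl⟩ := Abelian.Ext.contravariant_sequence_exact₃ h.shortExact (ModuleCat.of R N)
    e (Subsingleton.elim _ _) rfl
  -- In degree 1 the class is the connecting image of a map `A → N`; this map extends to `B`, so its
  -- image vanishes. In higher degree the class comes from a positive Ext of `A`.
  obtain rfl | hk := Nat.eq_zero_or_pos k
  · obtain ⟨f, rfl⟩ := Abelian.Ext.homEquiv₀.symm.surjective y
    obtain ⟨g, hg⟩ := hext f.hom
    have hf : f = ModuleCat.ofHom i ≫ ModuleCat.ofHom g := ModuleCat.hom_ext hg.symm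
    rw [Abelian.Ext.homEquiv₀_symm_apply, hf, ← Abelian.Ext.mk₀_comp_mk₀]
    exact h.shortExact.extClass_comp_assoc _
  · have := hA k hk
    rw [Subsingleton.elim y 0, Abelian.Ext.comp_zero]

theorem extVanishes_coker (h : IsShortExact i p) (hA : ExtVanishes R M A)
    (hB : ExtVanishes R M B) : ExtVanishes R M C := by
  intro k hk
  have := hB k hk
  have := hA (k + 1) (by lia)
  refine subsingleton_of_forall_eq 0 fun e => ?_
  obtain ⟨y, rfl⟩ := Abelian.Ext.covariant_sequence_exact₃ (ModuleCat.of R M) h.shortExact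
    e rfl (Subsingleton.elim _ _)
  rw [Subsingleton.elim y 0, Abelian.Ext.zero_comp]

end IsShortExact

theorem ExtVanishes.of_projective [Module.Projective R M] : ExtVanishes R M N := by
  intro k hk
  have : Projective (ModuleCat.of R M) := (IsProjective.iff_projective M).mp ‹_›
  exact HasProjectiveDimensionLT.subsingleton (ModuleCat.of R M) 1 k hk _

/-- The dimension shift behind every induction on resolutions: its right side mentions only maps and
smaller syzygies, so it can be compared across rings. -/
theorem IsShortExact.extVanishes_iff {i : A →ₗ[R] B} {p : B →ₗ[R] C} (h : IsShortExact i p)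
    [Module.Projective R B] :
    ExtVanishes R C N ↔
      ExtVanishes R A N ∧ ∀ f : A →ₗ[R] N, ∃ g : B →ₗ[R] N, g ∘ₗ i = f :=
  ⟨fun hC => ⟨h.extVanishes_left .of_projective hC, h.extend hC⟩,
    fun hA => h.extVanishes_right hA.1 .of_projective hA.2⟩

theorem ExtVanishes.retract_left (h : ExtVanishes R B N) (i : A →ₗ[R] B) (p : B →ₗ[R] A)
    (hip : p ∘ₗ i = LinearMap.id) : ExtVanishes R A N := by
  intro k hk
  have := h k hk
  refine subsingleton_of_forall_eq 0 fun e => ?_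
  have hid : ModuleCat.ofHom i ≫ ModuleCat.ofHom p = 𝟙 (ModuleCat.of R A) :=
    ModuleCat.hom_ext hip
  rw [← e.mk₀_id_comp, ← hid, ← Abelian.Ext.mk₀_comp_mk₀,
    Abelian.Ext.comp_assoc_of_second_deg_zero,
    Subsingleton.elim ((Abelian.Ext.mk₀ (ModuleCat.ofHom p)).comp e (zero_add k)) 0,
    Abelian.Ext.comp_zero]

theorem ExtVanishes.retract_right (h : ExtVanishes R M B) (i : A →ₗ[R] B) (p : B →ₗ[R] A)
    (hip : p ∘ₗ i = LinearMap.id) : ExtVanishes R M A := by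
  intro k hk
  have := h k hk
  refine subsingleton_of_forall_eq 0 fun e => ?_
  have hid : ModuleCat.ofHom i ≫ ModuleCat.ofHom p = 𝟙 (ModuleCat.of R A) :=
    ModuleCat.hom_ext hip
  rw [← e.comp_mk₀_id, ← hid, ← Abelian.Ext.mk₀_comp_mk₀,
    ← Abelian.Ext.comp_assoc_of_third_deg_zero,
    Subsingleton.elim (e.comp (Abelian.Ext.mk₀ (ModuleCat.ofHom i)) (add_zero k)) 0,
    Abelian.Ext.zero_comp]

/-- Every module embeds into an injective one. -/
theorem exists_isShortExact_injective (N : Type u) [AddCommGroup N] [Module R N] :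
    ∃ (I Q : Type u) (_ : AddCommGroup I) (_ : AddCommGroup Q) (_ : Module R I) (_ : Module R Q)
      (i : N →ₗ[R] I) (p : I →ₗ[R] Q), Injective (ModuleCat.of R I) ∧ IsShortExact i p := by
  let f := Injective.ι (ModuleCat.of R N)
  exact ⟨_, _, _, _, _, _, f.hom, _,
    inferInstanceAs (Injective (Injective.under (ModuleCat.of R N))),
    .of_injective ((ModuleCat.mono_iff_injective f).mp inferInstance)⟩

/-- Embedding `N` in an injective `I` with quotient `Q` shifts the degree down to 1. There a class
comes from a map `(ι →₀ M) → Q`, which lifts to `I` summand by summand. No finiteness is involved.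
-/
theorem subsingleton_ext_finsupp (ι : Type u) (k : ℕ) :
    ∀ (N : Type u) [AddCommGroup N] [Module R N],
      Subsingleton (Abelian.Ext.{u} (ModuleCat.of R M) (ModuleCat.of R N) (k + 1)) →
      Subsingleton (Abelian.Ext.{u} (ModuleCat.of R (ι →₀ M)) (ModuleCat.of R N) (k + 1)) := by
  induction k with
  | zero =>
    intro N _ _ hN
    obtain ⟨I, Q, _, _, _, _, i, p, hI, h⟩ := exists_isShortExact_injective (R := R) N
    refine subsingleton_of_forall_eq 0 fun e => ?_
    obtain ⟨y, rfl⟩ := Abelian.Ext.covariant_sequence_exact₁ (ModuleCat.of R (ι →₀ M))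
      h.shortExact e (Abelian.Ext.eq_zero_of_injective _) (zero_add 1)
    obtain ⟨f, rfl⟩ := Abelian.Ext.homEquiv₀.symm.surjective y
    choose g hg using fun j => h.lift_of_subsingleton hN (f.hom ∘ₗ Finsupp.lsingle j)
    have hf : f = ModuleCat.ofHom (Finsupp.lsum ℕ g) ≫ ModuleCat.ofHom p := by
      refine ModuleCat.hom_ext (Finsupp.lhom_ext' fun j => ?_)
      rw [← hg j]
      ext m
      simp
    rw [Abelian.Ext.homEquiv₀_symm_apply, hf, ← Abelian.Ext.mk₀_comp_mk₀,
      Abelian.Ext.comp_assoc_of_second_deg_zero, h.shortExact.comp_extClass,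
      Abelian.Ext.comp_zero]
  | succ k ih =>
    intro N _ _ hN
    obtain ⟨I, Q, _, _, _, _, i, p, hI, h⟩ := exists_isShortExact_injective (R := R) N
    have hQ : Subsingleton (Abelian.Ext.{u} (ModuleCat.of R M) (ModuleCat.of R Q) (k + 1)) := by
      refine subsingleton_of_forall_eq 0 fun e => ?_
      obtain ⟨y, rfl⟩ := Abelian.Ext.covariant_sequence_exact₃ (ModuleCat.of R M) h.shortExact
        e rfl (Subsingleton.elim _ _)
      rw [Abelian.Ext.eq_zero_of_injective y, Abelian.Ext.zero_comp]
    have := ih Q hQ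
    refine subsingleton_of_forall_eq 0 fun e => ?_
    obtain ⟨y, rfl⟩ := Abelian.Ext.covariant_sequence_exact₁ (ModuleCat.of R (ι →₀ M))
      h.shortExact e (Abelian.Ext.eq_zero_of_injective _) rfl
    rw [Subsingleton.elim y 0, Abelian.Ext.zero_comp]

theorem ExtVanishes.finsupp_left (h : ExtVanishes R M N) (ι : Type u) :
    ExtVanishes R (ι →₀ M) N := by
  intro k hk
  obtain ⟨k, rfl⟩ : ∃ l, k = l + 1 := ⟨k - 1, by lia⟩
  exact subsingleton_ext_finsupp ι k N (h _ hk)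

end ExtVanishing

/-! ### Resolutions by finitely generated projectives. -/

section Resolutions

variable {R : Type u} [Ring R]

/-- `M` has a resolution of length at most `n` by finitely generated projective modules. -/
def HasFiniteResolution (R : Type u) [Ring R] :
    ℕ → ∀ (M : Type u) [AddCommGroup M] [Module R M], Prop
  | 0, M, _, _ => Module.Finite R M ∧ Module.Projective R M
  | n + 1, M, _, _ => ∃ (K P : ModuleCat.{u} R) (i : K →ₗ[R] P) (p : P →ₗ[R] M),
      IsShortExact i p ∧ Module.Finite R P ∧ Module.Projective R P ∧ HasFiniteResolution R n K

/-- `M` has a resolution by finitely generated projective modules, in elementary terms. -/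
def HasResolution (R : Type u) [Ring R] (M : Type u) [AddCommGroup M] [Module R M] : Prop :=
  ∃ (P : ℕ → ModuleCat.{u} R) (ε : P 0 →ₗ[R] M) (d : ∀ i, P (i + 1) →ₗ[R] P i),
    Function.Surjective ε ∧ Function.Exact (d 0) ε ∧ (∀ i, Function.Exact (d (i + 1)) (d i)) ∧
    ∀ i, Module.Finite R (P i) ∧ Module.Projective R (P i)

variable {M : Type u} [AddCommGroup M] [Module R M]

theorem StronglyFinitelyPresented.hasResolution (h : StronglyFinitelyPresented R M) :
    HasResolution R M := by
  obtain ⟨P, hP⟩ := h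
  refine ⟨P.complex.X, (P.π.f 0).hom, fun i => (P.complex.d (i + 1) i).hom, ?_, ?_, ?_, ?_⟩
  · exact (ModuleCat.epi_iff_surjective (P.π.f 0)).mp inferInstance
  · exact (ShortComplex.ShortExact.moduleCat_exact_iff_function_exact
      (ShortComplex.mk _ _ P.complex_d_comp_π_f_zero)).mp
      (ShortComplex.exact_of_g_is_cokernel _ P.isColimitCokernelCofork)
  · intro i
    exact (ShortComplex.ShortExact.moduleCat_exact_iff_function_exact _).mp (P.exact_succ i)
  · exact fun i => ⟨hP i, (IsProjective.iff_projective _).mpr (P.projective i)⟩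

theorem HasResolution.stronglyFinitelyPresented (h : HasResolution R M) :
    StronglyFinitelyPresented R M := by
  obtain ⟨P, ε, d, hε, h0, hd, hP⟩ := h
  let K : ChainComplex (ModuleCat.{u} R) ℕ := ChainComplex.of P (fun i => ModuleCat.ofHom (d i))
    fun i => ModuleCat.hom_ext (hd i).linearMap_comp_eq_zero
  have hK (i : ℕ) : K.d (i + 1) i = ModuleCat.ofHom (d i) :=
    ChainComplex.of_d P (fun i => ModuleCat.ofHom (d i)) i
  have hex (i : ℕ) : K.ExactAt (i + 1) := by
    rw [HomologicalComplex.exactAt_iff' _ (i + 1 + 1) (i + 1) i (by simp) (by simp),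
      ShortComplex.ShortExact.moduleCat_exact_iff_function_exact]
    simp only [HomologicalComplex.sc', HomologicalComplex.shortComplexFunctor', hK]
    exact hd i
  have hpr (i : ℕ) : Projective (K.X i) :=
    have := (hP i).2
    (IsProjective.iff_projective (P i)).mp this
  have h0' : K.d 1 0 ≫ ModuleCat.ofHom ε = 0 := by
    rw [hK]; exact ModuleCat.hom_ext h0.linearMap_comp_eq_zero
  let Q : ProjectiveResolution (ModuleCat.of R M) :=
    { complex := K
      projective := hpr
      π := (ChainComplex.toSingle₀Equiv _ _).symm ⟨ModuleCat.ofHom ε, h0'⟩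
      quasiIso := ⟨fun n => by
        cases n with
        | zero =>
          rw [ChainComplex.quasiIsoAt₀_iff, ShortComplex.quasiIso_iff_of_zeros']
          · refine (ShortComplex.exact_and_epi_g_iff_of_iso
              (S₂ := ShortComplex.mk (K.d 1 0) (ModuleCat.ofHom ε) h0') ?_).2
              ⟨?_, (ModuleCat.epi_iff_surjective _).mpr hε⟩
            · exact ShortComplex.isoMk (Iso.refl _) (Iso.refl _) (Iso.refl _)
                ((Category.id_comp _).trans (Category.comp_id _).symm)
                ((Category.id_comp _).trans (Category.comp_id _).symm)
            · rw [ShortComplex.ShortExact.moduleCat_exact_iff_function_exact]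
              simp only [hK]
              exact h0
          all_goals rfl
        | succ n =>
          rw [quasiIsoAt_iff_exactAt']
          · exact hex n
          · apply ChainComplex.exactAt_succ_single_obj⟩ }
  exact ⟨Q, fun i => (hP i).1⟩

theorem HasResolution.exists_isShortExact (h : HasResolution R M) :
    ∃ (K P : ModuleCat.{u} R) (i : K →ₗ[R] P) (p : P →ₗ[R] M), IsShortExact i p ∧
      Module.Finite R P ∧ Module.Projective R P ∧ HasResolution R K := by
  obtain ⟨P, ε, d, hε, h0, hd, hP⟩ := h
  refine ⟨ModuleCat.of R (LinearMap.ker ε), P 0, (LinearMap.ker ε).subtype, ε,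
    .of_surjective hε, (hP 0).1, (hP 0).2, fun i => P (i + 1),
    (d 0).codRestrict _ h0.apply_apply_eq_zero, fun i => d (i + 1), ?_, ?_,
    fun i => hd (i + 1), fun i => hP (i + 1)⟩
  · rintro ⟨y, hy⟩
    obtain ⟨z, rfl⟩ := (h0 y).mp hy
    exact ⟨z, rfl⟩
  · intro y
    rw [← hd 0 y, Subtype.ext_iff]
    rfl

theorem HasResolution.finite (h : HasResolution R M) : Module.Finite R M := by
  obtain ⟨P, ε, d, hε, -, -, hP⟩ := h
  have := (hP 0).1
  exact Module.Finite.of_surjective ε hε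

theorem HasResolution.of_isShortExact {K P : Type u} [AddCommGroup K] [Module R K] [AddCommGroup P]
    [Module R P] [hf : Module.Finite R P] [hp : Module.Projective R P] {i : K →ₗ[R] P}
    {p : P →ₗ[R] M} (h : IsShortExact i p) (hK : HasResolution R K) : HasResolution R M := by
  obtain ⟨Q, ε, d, hε, h0, hd, hQ⟩ := hK
  refine ⟨fun | 0 => ModuleCat.of R P | j + 1 => Q j, p,
    fun | 0 => i ∘ₗ ε | j + 1 => d j, h.surjective, ?_, ?_, ?_⟩
  · intro y
    rw [h.exact y]
    constructor
    · rintro ⟨k, rfl⟩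
      obtain ⟨q, rfl⟩ := hε k
      exact ⟨q, rfl⟩
    · rintro ⟨q, rfl⟩
      exact ⟨ε q, rfl⟩
  · rintro (_ | j)
    · intro y
      rw [← h0 y]
      exact (map_eq_zero_iff i h.injective)
    · exact hd j
  · rintro (_ | j)
    · exact ⟨hf, hp⟩
    · exact hQ j

theorem HasResolution.of_subsingleton [Subsingleton M] : HasResolution R M :=
  ⟨fun _ => ModuleCat.of R PUnit, 0, fun _ => 0, fun _ => ⟨0, Subsingleton.elim _ _⟩,
    fun _ => ⟨fun _ => ⟨0, Subsingleton.elim _ _⟩, fun _ => Subsingleton.elim _ _⟩,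
    fun _ _ => ⟨fun _ => ⟨0, Subsingleton.elim _ _⟩, fun _ => Subsingleton.elim _ _⟩,
    fun _ => ⟨inferInstanceAs (Module.Finite R PUnit.{u + 1}),
      inferInstanceAs (Module.Projective R PUnit.{u + 1})⟩⟩

theorem HasFiniteResolution.hasResolution {n : ℕ} :
    ∀ {M : Type u} [AddCommGroup M] [Module R M], HasFiniteResolution R n M →
      HasResolution R M := by
  induction n with
  | zero =>
    rintro M _ _ ⟨_, _⟩
    exact .of_isShortExact (K := PUnit) (i := 0) (p := LinearMap.id)
      ⟨fun _ _ _ => rfl, fun y => ⟨fun hy => ⟨0, hy.symm⟩, by rintro ⟨_, rfl⟩; rfl⟩,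
        Function.surjective_id⟩ .of_subsingleton
  | succ n ih =>
    rintro M _ _ ⟨K, P, i, p, h, _, _, hK⟩
    exact .of_isShortExact h (ih hK)

theorem HasFiniteResolution.finite {n : ℕ} (h : HasFiniteResolution R n M) : Module.Finite R M :=
  h.hasResolution.finite

theorem HasFiniteResolution.hasProjectiveDimensionLE {n : ℕ} :
    ∀ {M : Type u} [AddCommGroup M] [Module R M], HasFiniteResolution R n M →
      HasProjectiveDimensionLE (ModuleCat.of R M) n := by
  induction n with
  | zero =>
    rintro M _ _ ⟨_, hM⟩
    exact (projective_iff_hasProjectiveDimensionLE_zero _).mp ((IsProjective.iff_projective M).mp hM)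
  | succ n ih =>
    rintro M _ _ ⟨K, P, i, p, h, _, hP, hK⟩
    exact (h.shortExact.hasProjectiveDimensionLT_X₃_iff n
      ((IsProjective.iff_projective P).mp hP)).mpr (ih hK)

theorem projective_of_hasProjectiveDimensionLE_zero
    (h : HasProjectiveDimensionLE (ModuleCat.of R M) 0) : Module.Projective R M :=
  (IsProjective.iff_projective M).mpr ((projective_iff_hasProjectiveDimensionLE_zero _).mpr h)

theorem IsShortExact.hasProjectiveDimensionLE_iff {K P : Type u} [AddCommGroup K] [Module R K]
    [AddCommGroup P] [Module R P] [hP : Module.Projective R P] {i : K →ₗ[R] P}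
    {p : P →ₗ[R] M} (h : IsShortExact i p) (n : ℕ) :
    HasProjectiveDimensionLE (ModuleCat.of R M) (n + 1) ↔
      HasProjectiveDimensionLE (ModuleCat.of R K) n :=
  h.shortExact.hasProjectiveDimensionLT_X₃_iff n ((IsProjective.iff_projective P).mp hP)

/-- The `n`-th syzygy of the given resolution has projective dimension 0 and is finitely generated,
being covered by the next term. -/
theorem HasResolution.hasFiniteResolution {n : ℕ} :
    ∀ {M : Type u} [AddCommGroup M] [Module R M], HasResolution R M →
      HasProjectiveDimensionLE (ModuleCat.of R M) n → HasFiniteResolution R n M := by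
  induction n with
  | zero =>
    intro M _ _ h hn
    exact ⟨h.finite, projective_of_hasProjectiveDimensionLE_zero hn⟩
  | succ n ih =>
    intro M _ _ h hn
    obtain ⟨K, P, i, p, hs, hf, hp, hK⟩ := h.exists_isShortExact
    exact ⟨K, P, i, p, hs, hf, hp, ih hK ((hs.hasProjectiveDimensionLE_iff n).mp hn)⟩

/-- A map from a finitely generated module to a direct sum lands in a finite subsum. -/
theorem exists_finset_eq_sum {N : Type u} [AddCommGroup N] [Module R N] [Module.Finite R M]
    {ι : Type u} (f : M →ₗ[R] (ι →₀ N)) :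
    ∃ s : Finset ι, f = ∑ j ∈ s, Finsupp.lsingle j ∘ₗ Finsupp.lapply j ∘ₗ f := by
  classical
  obtain ⟨S, hS⟩ := Module.Finite.fg_top (R := R) (M := M)
  refine ⟨S.biUnion fun m => (f m).support, LinearMap.ext_on hS fun m hm => ?_⟩
  ext j
  simp only [LinearMap.sum_apply, LinearMap.comp_apply, Finsupp.lapply_apply,
    Finsupp.lsingle_apply, Finsupp.finsetSum_apply, Finsupp.single_apply]
  rw [Finset.sum_ite_eq']
  split_ifs with hj
  · rfl
  · by_contra h
    exact hj (Finset.mem_biUnion.mpr ⟨m, hm, Finsupp.mem_support_iff.mpr h⟩)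

/-- As `A` is finitely generated, only finitely many coordinates of `f` matter; their extensions can
be summed. -/
theorem exists_comp_eq_finsupp {A B N : Type u} [AddCommGroup A] [Module R A] [AddCommGroup B]
    [Module R B] [AddCommGroup N] [Module R N] [Module.Finite R A] {i : A →ₗ[R] B}
    (h : ∀ f : A →ₗ[R] N, ∃ g : B →ₗ[R] N, g ∘ₗ i = f) {ι : Type u} (f : A →ₗ[R] (ι →₀ N)) :
    ∃ g : B →ₗ[R] (ι →₀ N), g ∘ₗ i = f := by
  obtain ⟨s, hs⟩ := exists_finset_eq_sum f
  choose g hg using fun j => h (Finsupp.lapply j ∘ₗ f)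
  refine ⟨∑ j ∈ s, Finsupp.lsingle j ∘ₗ g j, ?_⟩
  rw [hs]
  ext1 a
  simp only [LinearMap.comp_apply, LinearMap.sum_apply]
  exact Finset.sum_congr rfl fun j _ => congrArg _ (LinearMap.congr_fun (hg j) a)

/-- Reduces (T2) for all cardinals to one copy of `T`; it applies because every syzygy is finitely
generated. -/
theorem HasFiniteResolution.extVanishes_finsupp {N : Type u} [AddCommGroup N] [Module R N]
    (ι : Type u) {n : ℕ} : ∀ {M : Type u} [AddCommGroup M] [Module R M],
      HasFiniteResolution R n M → ExtVanishes R M N → ExtVanishes R M (ι →₀ N) := by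
  induction n with
  | zero =>
    rintro M _ _ ⟨_, _⟩ -
    exact .of_projective
  | succ n ih =>
    rintro M _ _ ⟨K, P, i, p, h, _, _, hK⟩ hM
    rw [h.extVanishes_iff] at hM ⊢
    have := hK.finite
    exact ⟨ih hK hM.1, exists_comp_eq_finsupp hM.2⟩

end Resolutions

/-! ### Finite `Add T`-coresolutions and left approximations. -/

section AddCoresolutions

variable {R : Type u} [Ring R] {T M N S : Type u} [AddCommGroup T] [Module R T]
  [AddCommGroup M] [Module R M] [AddCommGroup N] [Module R N] [AddCommGroup S] [Module R S]

theorem IsInAdd.retract (h : IsInAdd R T N) (i : M →ₗ[R] N) (p : N →ₗ[R] M)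
    (hip : p ∘ₗ i = LinearMap.id) : IsInAdd R T M := by
  obtain ⟨ι, j, q, hjq⟩ := h
  refine ⟨ι, j ∘ₗ i, p ∘ₗ q, ?_⟩
  rw [LinearMap.comp_assoc, ← LinearMap.comp_assoc i, hjq, LinearMap.id_comp, hip]

theorem isInAdd_finsupp (R T : Type u) [Ring R] [AddCommGroup T] [Module R T] (ι : Type u) :
    IsInAdd R T (ι →₀ T) :=
  ⟨ι, LinearMap.id, LinearMap.id, rfl⟩

theorem isInAdd_self (R T : Type u) [Ring R] [AddCommGroup T] [Module R T] : IsInAdd R T T :=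
  (isInAdd_finsupp R T PUnit).retract (Finsupp.lsingle PUnit.unit) (Finsupp.lapply PUnit.unit)
    (LinearMap.ext fun t => by simp)

theorem IsInAdd.of_subsingleton [Subsingleton M] : IsInAdd R T M :=
  (isInAdd_finsupp R T PUnit).retract 0 0 (LinearMap.ext fun _ => Subsingleton.elim _ _)

theorem IsInAdd.prod (hM : IsInAdd R T M) (hS : IsInAdd R T S) : IsInAdd R T (M × S) := by
  obtain ⟨ι, i, p, h⟩ := hM
  obtain ⟨κ, j, q, h'⟩ := hS
  refine (isInAdd_finsupp R T (ι ⊕ κ)).retract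
    ((Finsupp.sumFinsuppLEquivProdFinsupp R).symm.toLinearMap ∘ₗ i.prodMap j)
    (p.prodMap q ∘ₗ (Finsupp.sumFinsuppLEquivProdFinsupp R).toLinearMap) ?_
  refine LinearMap.ext fun x => ?_
  simpa using Prod.ext (LinearMap.congr_fun h x.1) (LinearMap.congr_fun h' x.2)

theorem isInAdd_self_of_projective [Module.Projective R M] : IsInAdd R R M := by
  obtain ⟨s, hs⟩ := Module.projective_def'.mp ‹Module.Projective R M›
  exact ⟨M, s, _, hs⟩

theorem IsInAdd.projective (h : IsInAdd R R M) : Module.Projective R M := by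
  obtain ⟨ι, i, p, h⟩ := h
  exact Module.Projective.of_split i p h

/-- `M` has a finite coresolution `0 → M → C₀ → ⋯ → C_k → 0` by modules in `Add T`. -/
def HasFiniteAddCoresolution (R T : Type u) [Ring R] [AddCommGroup T] [Module R T] :
    ℕ → ∀ (M : Type u) [AddCommGroup M] [Module R M], Prop
  | 0, M, _, _ => IsInAdd R T M
  | k + 1, M, _, _ => ∃ (C D : ModuleCat.{u} R) (i : M →ₗ[R] C) (p : C →ₗ[R] D),
      IsShortExact i p ∧ IsInAdd R T C ∧ HasFiniteAddCoresolution R T k D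

namespace HasFiniteAddCoresolution

theorem of_sequence {k : ℕ} : ∀ {M : Type u} [AddCommGroup M] [Module R M]
    (C : ℕ → ModuleCat.{u} R) (ε : M →ₗ[R] C 0) (d : ∀ i : ℕ, C i →ₗ[R] C (i + 1)),
    Function.Injective ε → Function.Exact ε (d 0) → (∀ i : ℕ, Function.Exact (d i) (d (i + 1))) →
    (∀ i : ℕ, i ≤ k → IsInAdd R T (C i)) → (∀ i : ℕ, k < i → Subsingleton (C i)) →
    HasFiniteAddCoresolution R T k M := by
  induction k with
  | zero =>
    intro M _ _ C ε d hε h0 hd hC hC'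
    have := hC' 1 one_pos
    let e := LinearEquiv.ofBijective ε
      ⟨hε, fun c => (h0 c).mp (Subsingleton.elim _ _)⟩
    exact (hC 0 le_rfl).retract e.toLinearMap e.symm.toLinearMap (by ext; simp)
  | succ k ih =>
    intro M _ _ C ε d hε h0 hd hC hC'
    refine ⟨C 0, ModuleCat.of R (LinearMap.range (d 0)), ε, (d 0).rangeRestrict,
      ⟨hε, fun c => ?_, (d 0).surjective_rangeRestrict⟩, hC 0 (Nat.zero_le _), ?_⟩
    · rw [← h0 c, Subtype.ext_iff]
      rfl
    · refine ih (fun i => C (i + 1)) (LinearMap.range (d 0)).subtype (fun i => d (i + 1))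
        Subtype.val_injective (fun c => ?_) (fun i => hd (i + 1))
        (fun i hi => hC (i + 1) (by lia)) (fun i hi => hC' (i + 1) (by lia))
      rw [hd 0 c]
      simp

theorem exists_sequence {k : ℕ} : ∀ {M : Type u} [AddCommGroup M] [Module R M],
    HasFiniteAddCoresolution R T k M →
    ∃ (C : ℕ → ModuleCat.{u} R) (ε : M →ₗ[R] C 0) (d : ∀ i : ℕ, C i →ₗ[R] C (i + 1)),
    Function.Injective ε ∧ Function.Exact ε (d 0) ∧ (∀ i : ℕ, Function.Exact (d i) (d (i + 1))) ∧
    (∀ i : ℕ, i ≤ k → IsInAdd R T (C i)) ∧ (∀ i : ℕ, k < i → Subsingleton (C i)) := by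
  induction k with
  | zero =>
    intro M _ _ h
    refine ⟨fun | 0 => ModuleCat.of R M | _ + 1 => ModuleCat.of R PUnit, LinearMap.id,
      fun | 0 => 0 | _ + 1 => 0, Function.injective_id, fun m => ⟨fun _ => ⟨m, rfl⟩, fun _ => rfl⟩,
      ?_, ?_, ?_⟩
    · rintro (_ | i)
      · exact fun _ => ⟨fun _ => ⟨0, rfl⟩, fun _ => rfl⟩
      · exact fun _ => ⟨fun _ => ⟨0, rfl⟩, fun _ => rfl⟩
    · rintro (_ | i) hi
      · exact h
      · lia
    · rintro (_ | i) hi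
      · lia
      · exact inferInstanceAs (Subsingleton PUnit.{u + 1})
  | succ k ih =>
    rintro M _ _ ⟨C, D, i, p, h, hC, hD⟩
    obtain ⟨E, ε, d, hε, h0, hd, hE, hE'⟩ := ih hD
    refine ⟨fun | 0 => C | j + 1 => E j, i, fun | 0 => ε ∘ₗ p | j + 1 => d j, h.injective,
      ?_, ?_, ?_, ?_⟩
    · intro c
      rw [← h.exact c]
      exact map_eq_zero_iff ε hε
    · rintro (_ | j)
      · intro e
        rw [h0 e]
        constructor
        · rintro ⟨x, rfl⟩
          obtain ⟨c, rfl⟩ := h.surjective x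
          exact ⟨c, rfl⟩
        · rintro ⟨c, rfl⟩
          exact ⟨p c, rfl⟩
      · exact hd j
    · rintro (_ | j) hj
      · exact hC
      · exact hE j (by lia)
    · rintro (_ | j) hj
      · lia
      · exact hE' j (by lia)

theorem _root_.hasAddCoresolution_iff :
    HasAddCoresolution R T ↔ ∃ k, HasFiniteAddCoresolution R T k R := by
  constructor
  · rintro ⟨k, C, ε, d, hε, h0, hd, hC, hC'⟩
    exact ⟨k, of_sequence C ε d hε h0 hd hC hC'⟩
  · rintro ⟨k, h⟩
    exact ⟨k, h.exists_sequence⟩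

theorem congr {k : ℕ} (e : M ≃ₗ[R] N) (h : HasFiniteAddCoresolution R T k M) :
    HasFiniteAddCoresolution R T k N := by
  cases k with
  | zero =>
    exact IsInAdd.retract h e.symm.toLinearMap e.toLinearMap (by ext; simp)
  | succ k =>
    obtain ⟨C, D, i, p, h, hC, hD⟩ := h
    refine ⟨C, D, i ∘ₗ e.symm.toLinearMap, p, ⟨h.injective.comp e.symm.injective, fun c => ?_,
      h.surjective⟩, hC, hD⟩
    rw [h.exact c]
    exact ⟨fun ⟨m, hm⟩ => ⟨e m, by simpa using hm⟩, fun ⟨m, hm⟩ => ⟨e.symm m, hm⟩⟩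

theorem succ {k : ℕ} : ∀ {M : Type u} [AddCommGroup M] [Module R M],
    HasFiniteAddCoresolution R T k M → HasFiniteAddCoresolution R T (k + 1) M := by
  induction k with
  | zero =>
    intro M _ _ h
    exact ⟨ModuleCat.of R M, ModuleCat.of R PUnit, LinearMap.id, 0, ⟨Function.injective_id,
      fun m => ⟨fun _ => ⟨m, rfl⟩, fun _ => rfl⟩, fun _ => ⟨0, rfl⟩⟩, h,
      IsInAdd.of_subsingleton (M := PUnit.{u + 1})⟩
  | succ k ih =>
    rintro M _ _ ⟨C, D, i, p, h, hC, hD⟩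
    exact ⟨C, D, i, p, h, hC, ih hD⟩

theorem mono {k l : ℕ} (hkl : k ≤ l) (h : HasFiniteAddCoresolution R T k M) :
    HasFiniteAddCoresolution R T l M := by
  induction l, hkl using Nat.le_induction with
  | base => exact h
  | succ l _ ih => exact ih.succ

theorem prod {k : ℕ} (hM : HasFiniteAddCoresolution R T k M) (hS : IsInAdd R T S) :
    HasFiniteAddCoresolution R T k (M × S) := by
  cases k with
  | zero => exact IsInAdd.prod hM hS
  | succ k =>
    obtain ⟨C, D, i, p, h, hC, hD⟩ := hM
    refine ⟨ModuleCat.of R (C × S), D, i.prodMap LinearMap.id, p ∘ₗ LinearMap.fst R C S,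
      ⟨h.injective.prodMap Function.injective_id, ?_,
        h.surjective.comp Prod.fst_surjective⟩, hC.prod hS, hD⟩
    rintro ⟨c, s⟩
    rw [LinearMap.comp_apply, LinearMap.fst_apply, h.exact c]
    exact ⟨fun ⟨m, hm⟩ => ⟨(m, s), Prod.ext hm rfl⟩,
      fun ⟨m, hm⟩ => ⟨m.1, congrArg Prod.fst hm⟩⟩

end HasFiniteAddCoresolution

/-- `f : M → C` is a left `Add T`-approximation up to the requirement that `C` is in `Add T`. -/
def IsLeftAddApprox (T : Type u) [AddCommGroup T] [Module R T] (f : M →ₗ[R] N) : Prop :=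
  ∀ (ι : Type u) (g : M →ₗ[R] (ι →₀ T)), ∃ h : N →ₗ[R] (ι →₀ T), h ∘ₗ f = g

theorem IsLeftAddApprox.exists_comp_eq {f : M →ₗ[R] N} (h : IsLeftAddApprox T f)
    (hS : IsInAdd R T S) (g : M →ₗ[R] S) : ∃ g' : N →ₗ[R] S, g' ∘ₗ f = g := by
  obtain ⟨ι, i, p, hip⟩ := hS
  obtain ⟨k, hk⟩ := h ι (i ∘ₗ g)
  exact ⟨p ∘ₗ k, by rw [LinearMap.comp_assoc, hk, ← LinearMap.comp_assoc, hip, LinearMap.id_comp]⟩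

section Selforthogonal

variable (hT : ∀ ι : Type u, ExtVanishes R T (ι →₀ T))

include hT

theorem IsInAdd.extVanishes (hM : IsInAdd R T M) (hS : IsInAdd R T S) : ExtVanishes R M S := by
  obtain ⟨ι, i, p, hip⟩ := hM
  obtain ⟨κ, j, q, hjq⟩ := hS
  exact ((hT κ).finsupp_left ι |>.retract_left i p hip).retract_right j q hjq

theorem HasFiniteAddCoresolution.extVanishes {k : ℕ} (hS : IsInAdd R T S) :
    ∀ {M : Type u} [AddCommGroup M] [Module R M], HasFiniteAddCoresolution R T k M →
      ExtVanishes R M S := by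
  induction k with
  | zero => exact fun hM => IsInAdd.extVanishes hT hM hS
  | succ k ih =>
    rintro M _ _ ⟨C, D, i, p, h, hC, hD⟩
    exact h.extVanishes_left (IsInAdd.extVanishes hT hC hS) (ih hD)

/-- The projection `M × S → S` extends to `r : C → S` because Ext¹(D, S) vanishes. Then `M` embeds
into `C` with cokernel `D × S`, so the summand moves one step to the right without changing the
length. -/
theorem HasFiniteAddCoresolution.of_prod {k : ℕ} (hS : IsInAdd R T S)
    (hM : HasFiniteAddCoresolution R T k (M × S)) : HasFiniteAddCoresolution R T k M := by
  cases k with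
  | zero => exact IsInAdd.retract hM (LinearMap.inl R M S) (LinearMap.fst R M S) (by ext; simp)
  | succ k =>
    obtain ⟨C, D, i, p, h, hC, hD⟩ := hM
    obtain ⟨r, hr⟩ := h.extend (hD.extVanishes hT hS) (LinearMap.snd R M S)
    have hr' (m : M) (s : S) : r (i (m, s)) = s := LinearMap.congr_fun hr (m, s)
    refine ⟨C, ModuleCat.of R (D × S), i ∘ₗ LinearMap.inl R M S, p.prod r,
      ⟨h.injective.comp LinearMap.inl_injective, fun c => ?_, fun x => ?_⟩, hC, hD.prod hS⟩
    · constructor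
      · intro hc
        obtain ⟨⟨m, s⟩, rfl⟩ := (h.exact c).mp (congrArg Prod.fst hc)
        obtain rfl : s = 0 := (hr' m s).symm.trans (congrArg Prod.snd hc)
        exact ⟨m, rfl⟩
      · rintro ⟨m, rfl⟩
        exact Prod.ext (h.apply_apply _) (hr' m 0)
    · obtain ⟨c, hc⟩ := h.surjective x.1
      -- Adding an element of `i (0 × S)` corrects the `S`-coordinate without changing the image in
      -- `D`.
      refine ⟨c + i (0, x.2 - r c), Prod.ext ?_ ?_⟩
      · change p (c + i (0, x.2 - r c)) = x.1
        rw [map_add, h.apply_apply, add_zero, hc]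
      · change r (c + i (0, x.2 - r c)) = x.2
        rw [map_add, hr', add_sub_cancel]

/-- The cokernel of any left `Add T`-approximation of a module with an `Add T`-coresolution has a
shorter coresolution. -/
theorem HasFiniteAddCoresolution.of_isLeftAddApprox {k : ℕ}
    (hM : HasFiniteAddCoresolution R T (k + 1) M) (hN : IsInAdd R T N) {f : M →ₗ[R] N}
    (hf : IsLeftAddApprox T f) :
    Function.Injective f ∧ ∀ {Q : Type u} [AddCommGroup Q] [Module R Q] (π : N →ₗ[R] Q),
      Function.Exact f π → Function.Surjective π → HasFiniteAddCoresolution R T k Q := by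
  obtain ⟨C, D, ε, ρ, h, hC, hD⟩ := hM
  obtain ⟨a, ha⟩ := hf.exists_comp_eq hC ε
  have ha' (m : M) : a (f m) = ε m := LinearMap.congr_fun ha m
  obtain ⟨b, hb⟩ := h.extend (hD.extVanishes hT hN) f
  have hb' (m : M) : b (ε m) = f m := LinearMap.congr_fun hb m
  refine ⟨fun m m' hm => h.injective (by rw [← ha', ← ha', hm]), fun {Q} _ _ π hπ hπ' => ?_⟩
  -- Schanuel's argument: both `q₁` and `q₂` are surjective with kernel the image of `M` under `(ε,
  -- f)`, so `D × N` and `Q × C` are isomorphic. Cancelling `C` leaves a coresolution of `Q` as long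
  -- as that of `D`.
  let q₁ : C × N →ₗ[R] D × N := (ρ ∘ₗ LinearMap.fst R C N).prod
    (LinearMap.snd R C N - b ∘ₗ LinearMap.fst R C N)
  let q₂ : C × N →ₗ[R] Q × C := (π ∘ₗ LinearMap.snd R C N).prod
    (LinearMap.fst R C N - a ∘ₗ LinearMap.snd R C N)
  have hq₁ : Function.Surjective q₁ := by
    rintro ⟨d, y⟩
    obtain ⟨c, rfl⟩ := h.surjective d
    exact ⟨(c, y + b c), by simp [q₁]⟩
  have hq₂ : Function.Surjective q₂ := by
    rintro ⟨d, y⟩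
    obtain ⟨c, rfl⟩ := hπ' d
    exact ⟨(y + a c, c), by simp [q₂]⟩
  have hker : LinearMap.ker q₁ = LinearMap.ker q₂ := by
    ext ⟨c, y⟩
    change (ρ c, y - b c) = 0 ↔ (π y, c - a y) = 0
    rw [Prod.mk_eq_zero, Prod.mk_eq_zero, sub_eq_zero, sub_eq_zero]
    constructor
    · rintro ⟨hc, rfl⟩
      obtain ⟨m, rfl⟩ := (h.exact c).mp hc
      rw [hb', ha']
      exact ⟨hπ.apply_apply_eq_zero m, rfl⟩
    · rintro ⟨hy, rfl⟩
      obtain ⟨m, rfl⟩ := (hπ y).mp hy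
      rw [ha', hb']
      exact ⟨h.apply_apply m, rfl⟩
  exact .of_prod hT hC (((hD.prod hN)).congr ((q₁.quotKerEquivOfSurjective hq₁).symm ≪≫ₗ
    Submodule.quotEquivOfEq _ _ hker ≪≫ₗ q₂.quotKerEquivOfSurjective hq₂))

end Selforthogonal

end AddCoresolutions

/-! ### Extension of scalars, covering both reduction modulo `x` and localization. -/

section ScalarExtension

variable {L : Type u} [Ring L] (L' : Type u) [Ring L'] [Module L L']

/-- `j : M → M'` is an initial `L`-linear map from `M` to an `L'`-module. -/
structure IsScalarExtension {M M' : Type u} [AddCommGroup M] [Module L M] [AddCommGroup M']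
    [Module L M'] [Module L' M'] (j : M →ₗ[L] M') : Prop where
  span_range : Submodule.span L' (Set.range j) = ⊤
  exists_lift : ∀ (N : Type u) [AddCommGroup N] [Module L N] [Module L' N] [IsScalarTower L L' N]
    (f : M →ₗ[L] N), ∃ g : M' →ₗ[L'] N, ∀ m, g (j m) = f m

variable {L'}

theorem isScalarExtension_toSpanSingleton :
    IsScalarExtension L' (LinearMap.toSpanSingleton L L' 1) where
  span_range := by
    rw [eq_top_iff, ← Ideal.span_one, Submodule.span_le, Set.one_subset]
    exact Submodule.subset_span ⟨1, by simp⟩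
  exists_lift N _ _ _ _ f := ⟨LinearMap.toSpanSingleton L' N (f 1), fun r => by
    simp only [LinearMap.toSpanSingleton_apply, smul_assoc, one_smul]
    rw [← map_smul, smul_eq_mul, mul_one]⟩

variable {M M' N N' : Type u} [AddCommGroup M] [Module L M] [AddCommGroup M']
  [Module L M'] [Module L' M'] [AddCommGroup N] [Module L N]
  [AddCommGroup N'] [Module L N'] [Module L' N']

namespace IsScalarExtension

variable {j : M →ₗ[L] M'} {jN : N →ₗ[L] N'}

omit [Module L N'] in
theorem hom_ext (h : IsScalarExtension L' j) {f g : M' →ₗ[L'] N'}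
    (hfg : ∀ m, f (j m) = g (j m)) : f = g :=
  LinearMap.ext_on h.span_range (by rintro _ ⟨m, rfl⟩; exact hfg m)

theorem exists_map [IsScalarTower L L' N'] (h : IsScalarExtension L' j) (jN : N →ₗ[L] N')
    (f : M →ₗ[L] N) :
    ∃ f' : M' →ₗ[L'] N', ∀ m, f' (j m) = jN (f m) :=
  h.exists_lift N' (jN ∘ₗ f)

theorem finite [IsScalarTower L L' M'] (h : IsScalarExtension L' j) [Module.Finite L M] :
    Module.Finite L' M' := by
  obtain ⟨S, hS⟩ := Module.Finite.fg_top (R := L) (M := M)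
  classical
  refine ⟨S.image j, eq_top_iff.mpr (h.span_range.ge.trans (Submodule.span_le.mpr ?_))⟩
  rintro _ ⟨m, rfl⟩
  have hm : m ∈ Submodule.span L (S : Set M) := hS ▸ Submodule.mem_top
  rw [Finset.coe_image]
  refine Submodule.span_le_restrictScalars L L' (j '' S) ?_
  rw [← Submodule.map_span]
  exact Submodule.mem_map_of_mem hm

/-- The inclusion is transported through `jT` coordinatewise, the retraction one summand at a time,
so the direct sum itself need not be shown to be a scalar extension. -/
theorem isInAdd [IsScalarTower L L' M'] {T T' : Type u} [AddCommGroup T] [Module L T]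
    [AddCommGroup T'] [Module L T']
    [Module L' T'] [IsScalarTower L L' T'] {jT : T →ₗ[L] T'} (hT : IsScalarExtension L' jT)
    (h : IsScalarExtension L' j) (hM : IsInAdd L T M) : IsInAdd L' T' M' := by
  obtain ⟨ι, i, p, hip⟩ := hM
  obtain ⟨i', hi'⟩ := h.exists_map (Finsupp.mapRange.linearMap jT) i
  choose p' hp' using fun k : ι => hT.exists_map j (p ∘ₗ Finsupp.lsingle k)
  refine ⟨ι, i', Finsupp.lsum ℕ p', h.hom_ext fun m => ?_⟩
  have key (s : ι →₀ T) : Finsupp.lsum ℕ p' (Finsupp.mapRange.linearMap jT s) = j (p s) := by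
    induction s using Finsupp.induction_linear with
    | zero => simp
    | add s t hs ht => simp only [map_add, hs, ht]
    | single k t => simpa using hp' k t
  rw [LinearMap.comp_apply, hi', key, LinearMap.id_apply, ← LinearMap.comp_apply p, hip,
    LinearMap.id_apply]

theorem projective [IsScalarTower L L' L'] [IsScalarTower L L' M'] (h : IsScalarExtension L' j)
    [Module.Projective L M] :
    Module.Projective L' M' :=
  (isScalarExtension_toSpanSingleton.isInAdd h isInAdd_self_of_projective).projective

end IsScalarExtension

-- Inductive step of the change of rings for Ext: maps into an `L'`-module correspond under scalar
-- extension, so extending along `i` and along `i'` are the same problem.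
omit [Module L M'] in
theorem IsShortExact.extVanishes_iff_extVanishes [IsScalarTower L L' L']
    [IsScalarTower L L' N'] {K K' P P' : Type u}
    [AddCommGroup K] [Module L K] [AddCommGroup P] [Module L P] [AddCommGroup K'] [Module L K']
    [Module L' K'] [IsScalarTower L L' K'] [AddCommGroup P'] [Module L P'] [Module L' P']
    [IsScalarTower L L' P'] {i : K →ₗ[L] P} {p : P →ₗ[L] M} {i' : K' →ₗ[L'] P'}
    {p' : P' →ₗ[L'] M'} (h : IsShortExact i p) (h' : IsShortExact i' p') [Module.Projective L P]
    {jK : K →ₗ[L] K'} {jP : P →ₗ[L] P'} (hK : IsScalarExtension L' jK)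
    (hP : IsScalarExtension L' jP) (hi : ∀ k, i' (jK k) = jP (i k))
    (hEV : ExtVanishes L K N' ↔ ExtVanishes L' K' N') :
    ExtVanishes L M N' ↔ ExtVanishes L' M' N' := by
  have := hP.projective
  rw [h.extVanishes_iff, h'.extVanishes_iff, hEV]
  refine and_congr_right fun _ => ⟨fun H f => ?_, fun H f => ?_⟩
  · obtain ⟨g, hg⟩ := H ((f.restrictScalars L) ∘ₗ jK)
    obtain ⟨g', hg'⟩ := hP.exists_lift N' g
    refine ⟨g', hK.hom_ext fun k => ?_⟩
    rw [LinearMap.comp_apply, hi, hg']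
    exact LinearMap.congr_fun hg k
  · obtain ⟨f', hf'⟩ := hK.exists_lift N' f
    obtain ⟨g, hg⟩ := H f'
    refine ⟨(g.restrictScalars L) ∘ₗ jP, LinearMap.ext fun k => ?_⟩
    rw [LinearMap.comp_apply, LinearMap.comp_apply, ← hi, ← hf']
    exact LinearMap.congr_fun hg (jK k)

end ScalarExtension

section Central

variable {Λ : Type u} [Ring Λ] (x : Subring.center Λ)

/-! ### Reduction modulo `x`. -/

section Mod

/-- `j : M → M'` identifies `M'` with `M / xM`. -/
structure IsModBy {M M' : Type u} [AddCommGroup M] [Module Λ M] [AddCommGroup M'] [Module Λ M']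
    (j : M →ₗ[Λ] M') : Prop where
  surjective : Function.Surjective j
  eq_zero_iff : ∀ m, j m = 0 ↔ ∃ m', m = (x : Λ) • m'

theorem smul_center_comm {M : Type u} [AddCommGroup M] [Module Λ M] (r : Λ) (m : M) :
    r • (x : Λ) • m = (x : Λ) • r • m := by
  rw [smul_smul, smul_smul, center_mul_comm]

theorem mem_span_center_smul_top {M : Type u} [AddCommGroup M] [Module Λ M] (m : M) :
    m ∈ Ideal.span {(x : Λ)} • (⊤ : Submodule Λ M) ↔ ∃ m', m = (x : Λ) • m' := by
  constructor
  · intro hm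
    induction hm using Submodule.smul_induction_on' with
    | smul r hr n _ =>
      obtain ⟨c, rfl⟩ := Ideal.mem_span_singleton'.mp hr
      exact ⟨c • n, by rw [mul_smul, smul_center_comm]⟩
    | add a _ b _ ha hb =>
      obtain ⟨a, rfl⟩ := ha
      obtain ⟨b, rfl⟩ := hb
      exact ⟨a + b, (smul_add _ _ _).symm⟩
  · rintro ⟨m, rfl⟩
    exact Submodule.smul_mem_smul (Ideal.mem_span_singleton_self _) trivial

theorem isModBy_mkQ (M : Type u) [AddCommGroup M] [Module Λ M] :
    IsModBy x (Submodule.mkQ (Ideal.span {(x : Λ)} • (⊤ : Submodule Λ M)) : M →ₗ[Λ] ModMod x M) where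
  surjective := Submodule.mkQ_surjective _
  eq_zero_iff m := by
    rw [Submodule.mkQ_apply, Submodule.Quotient.mk_eq_zero, mem_span_center_smul_top]

theorem isModBy_ring : IsModBy x (LinearMap.toSpanSingleton Λ (RingMod x) 1) where
  surjective r := by
    obtain ⟨r, rfl⟩ := Ideal.Quotient.mk_surjective r
    exact ⟨r, congrArg (Ideal.Quotient.mk _) (mul_one r)⟩
  eq_zero_iff r := by
    have : LinearMap.toSpanSingleton Λ (RingMod x) 1 r = Ideal.Quotient.mk _ r :=
      congrArg (Ideal.Quotient.mk _) (mul_one r)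
    rw [this, Ideal.Quotient.eq_zero_iff_mem, Ideal.mem_span_singleton']
    simp only [center_mul_comm, eq_comm, smul_eq_mul]

namespace IsModBy

variable {x} {M M' : Type u} [AddCommGroup M] [Module Λ M] [AddCommGroup M'] [Module Λ M']
  [Module (RingMod x) M'] [IsScalarTower Λ (RingMod x) M'] {j : M →ₗ[Λ] M'}

omit [AddCommGroup M] [Module Λ M] in
theorem smul_eq_zero (m : M') : (x : Λ) • m = 0 := by
  rw [← one_smul (RingMod x) m, ← smul_assoc]
  have : (x : Λ) • (1 : RingMod x) = 0 :=
    ((isModBy_ring x).eq_zero_iff (x : Λ)).mpr ⟨1, (mul_one _).symm⟩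
  rw [this, zero_smul]

theorem isScalarExtension (h : IsModBy x j) : IsScalarExtension (RingMod x) j where
  span_range := by
    rw [h.surjective.range_eq, Submodule.span_univ]
  exists_lift N _ _ _ _ f := by
    have hs := IsShortExact.of_surjective h.surjective
    obtain ⟨g, hg⟩ := hs.exists_eq_comp_right f fun k => by
      obtain ⟨m, hm⟩ := (h.eq_zero_iff k).mp k.2
      rw [Submodule.subtype_apply, hm, map_smul, smul_eq_zero]
    refine ⟨{ toFun := g, map_add' := map_add g, map_smul' := fun r m => ?_ }, hg⟩
    obtain ⟨r, rfl⟩ := (isModBy_ring x).surjective r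
    rw [LinearMap.toSpanSingleton_apply, smul_assoc, one_smul, map_smul, RingHom.id_apply,
      smul_assoc, one_smul]

end IsModBy

/-- Torsion-freeness of `C` serves only the injectivity of `i'`: if `i a = x b`, then `x` kills `p
b`, so `b` comes from `A`. -/
theorem IsShortExact.modBy {A A' B B' C C' : Type u} [AddCommGroup A] [Module Λ A]
    [AddCommGroup A'] [Module Λ A'] [Module (RingMod x) A'] [AddCommGroup B] [Module Λ B]
    [AddCommGroup B'] [Module Λ B'] [Module (RingMod x) B'] [AddCommGroup C] [Module Λ C]
    [AddCommGroup C'] [Module Λ C'] [Module (RingMod x) C']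
    {i : A →ₗ[Λ] B} {p : B →ₗ[Λ] C} {jA : A →ₗ[Λ] A'} {jB : B →ₗ[Λ] B'} {jC : C →ₗ[Λ] C'}
    {i' : A' →ₗ[RingMod x] B'} {p' : B' →ₗ[RingMod x] C'}
    (h : IsShortExact i p) (hA : IsModBy x jA) (hB : IsModBy x jB) (hC : IsModBy x jC)
    (hi : ∀ a, i' (jA a) = jB (i a)) (hp : ∀ b, p' (jB b) = jC (p b))
    (hx : ∀ c : C, (x : Λ) • c = 0 → c = 0) : IsShortExact i' p' where
  injective := by
    rw [injective_iff_map_eq_zero]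
    intro y hy
    obtain ⟨a, rfl⟩ := hA.surjective y
    rw [hi, hB.eq_zero_iff] at hy
    obtain ⟨b, hb⟩ := hy
    obtain ⟨a', rfl⟩ := (h.exact b).mp (hx _ (by rw [← map_smul, ← hb, h.apply_apply]))
    rw [hA.eq_zero_iff]
    exact ⟨a', h.injective (by rw [hb, map_smul])⟩
  exact y := by
    obtain ⟨b, rfl⟩ := hB.surjective y
    constructor
    · intro hb
      rw [hp, hC.eq_zero_iff] at hb
      obtain ⟨c, hc⟩ := hb
      obtain ⟨b', rfl⟩ := h.surjective c
      obtain ⟨a, ha⟩ := (h.exact (b - (x : Λ) • b')).mp (by rw [map_sub, map_smul, hc, sub_self])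
      refine ⟨jA a, ?_⟩
      rw [hi, ha, map_sub, sub_eq_self, hB.eq_zero_iff]
      exact ⟨b', rfl⟩
    · rintro ⟨z, hz⟩
      obtain ⟨a, rfl⟩ := hA.surjective z
      rw [← hz, hi, hp, h.apply_apply, map_zero]
  surjective y := by
    obtain ⟨c, rfl⟩ := hC.surjective y
    obtain ⟨b, rfl⟩ := h.surjective c
    exact ⟨jB b, hp b⟩

/-- Reduction modulo `x` of a short exact sequence whose last term is `x`-torsion-free. -/
theorem IsShortExact.exists_modBy {A A' B B' C C' : Type u} [AddCommGroup A] [Module Λ A]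
    [AddCommGroup A'] [Module Λ A'] [Module (RingMod x) A'] [IsScalarTower Λ (RingMod x) A']
    [AddCommGroup B] [Module Λ B]
    [AddCommGroup B'] [Module Λ B'] [Module (RingMod x) B'] [IsScalarTower Λ (RingMod x) B']
    [AddCommGroup C] [Module Λ C]
    [AddCommGroup C'] [Module Λ C'] [Module (RingMod x) C'] [IsScalarTower Λ (RingMod x) C']
    {i : A →ₗ[Λ] B} {p : B →ₗ[Λ] C} {jA : A →ₗ[Λ] A'} {jB : B →ₗ[Λ] B'} {jC : C →ₗ[Λ] C'}
    (h : IsShortExact i p) (hA : IsModBy x jA) (hB : IsModBy x jB) (hC : IsModBy x jC)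
    (hx : ∀ c : C, (x : Λ) • c = 0 → c = 0) :
    ∃ (i' : A' →ₗ[RingMod x] B') (p' : B' →ₗ[RingMod x] C'), (∀ a, i' (jA a) = jB (i a)) ∧
      (∀ b, p' (jB b) = jC (p b)) ∧ IsShortExact i' p' := by
  obtain ⟨i', hi'⟩ := hA.isScalarExtension.exists_map jB i
  obtain ⟨p', hp'⟩ := hB.isScalarExtension.exists_map jC p
  exact ⟨i', p', hi', hp', h.modBy x hA hB hC hi' hp' hx⟩

end Mod

/-! ### Localization at the powers of `x`. -/

section Loc

/-- `j : M → M'` identifies `M'` with the localization `M_x`, provided that `x` acts bijectively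
on `M'`. -/
structure IsLocBy {M M' : Type u} [AddCommGroup M] [Module Λ M] [AddCommGroup M'] [Module Λ M']
    (j : M →ₗ[Λ] M') : Prop where
  exists_smul_eq : ∀ y, ∃ (k : ℕ) (m : M), (x : Λ) ^ k • y = j m
  exists_smul_eq_zero : ∀ m, j m = 0 → ∃ k : ℕ, (x : Λ) ^ k • m = 0

theorem smul_pow_center_comm {M : Type u} [AddCommGroup M] [Module Λ M] (k : ℕ) (r : Λ) (m : M) :
    r • (x : Λ) ^ k • m = (x : Λ) ^ k • r • m := by
  exact_mod_cast smul_center_comm (x ^ k) r m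

/-- The localization map `M → M_x`. -/
def locMk (M : Type u) [AddCommGroup M] [Module Λ M] : M →ₗ[Λ] ModLoc x M where
  toFun m := OreLocalization.oreDiv m 1
  map_add' _ _ := OreLocalization.add_oreDiv.symm
  map_smul' r m := (OreLocalization.smul_oreDiv_one r m).symm

theorem pow_smul_oreDiv {M : Type u} [AddCommGroup M] [Module Λ M] (m : M)
    (s : Submonoid.powers (x : Λ)) :
    (s : Λ) • (OreLocalization.oreDiv m s : ModLoc x M) = locMk x M m := by
  rw [← OreLocalization.oreDiv_one_smul]
  exact OreLocalization.smul_cancel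

theorem isLocBy_locMk (M : Type u) [AddCommGroup M] [Module Λ M] : IsLocBy x (locMk x M) where
  exists_smul_eq y := by
    induction y using OreLocalization.ind with | _ m s
    obtain ⟨k, hk⟩ := s.2
    refine ⟨k, m, ?_⟩
    rw [← pow_smul_oreDiv]
    exact congrArg (· • _) hk
  exists_smul_eq_zero m hm := by
    change OreLocalization.oreDiv m 1 = 0 at hm
    rw [OreLocalization.zero_def, OreLocalization.oreDiv_eq_iff] at hm
    obtain ⟨u, v, h1, h2⟩ := hm
    obtain ⟨k, hk⟩ := u.2
    simp only [OneMemClass.coe_one, mul_one] at h2 hk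
    refine ⟨k, ?_⟩
    rw [hk, h2, ← h1, smul_zero]

theorem toSpanSingleton_eq_locMk (r : Λ) :
    LinearMap.toSpanSingleton Λ (RingLoc x) 1 r = locMk x Λ r := by
  rw [LinearMap.toSpanSingleton_apply, OreLocalization.one_def, OreLocalization.smul_oreDiv_one,
    smul_eq_mul, mul_one]
  rfl

theorem isLocBy_ring : IsLocBy x (LinearMap.toSpanSingleton Λ (RingLoc x) 1) where
  exists_smul_eq y := by
    simp only [toSpanSingleton_eq_locMk]
    exact (isLocBy_locMk x Λ).exists_smul_eq y
  exists_smul_eq_zero r hr :=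
    (isLocBy_locMk x Λ).exists_smul_eq_zero r ((toSpanSingleton_eq_locMk x r).symm.trans hr)

theorem bijective_smul_of_loc (N : Type u) [AddCommGroup N] [Module Λ N] [Module (RingLoc x) N]
    [IsScalarTower Λ (RingLoc x) N] : Function.Bijective fun n : N => (x : Λ) • n := by
  let s : Submonoid.powers (x : Λ) := ⟨x, Submonoid.mem_powers _⟩
  let u : RingLoc x := OreLocalization.oreDiv 1 s
  let v : RingLoc x := OreLocalization.oreDiv (x : Λ) 1
  have huv : u * v = 1 := OreLocalization.mul_inv (1 : Submonoid.powers (x : Λ)) s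
  have hvu : v * u = 1 := OreLocalization.mul_inv s (1 : Submonoid.powers (x : Λ))
  have hv (n : N) : (x : Λ) • n = v • n := by
    rw [← one_smul (RingLoc x) n, ← smul_assoc, ← OreLocalization.oreDiv_one_smul, smul_eq_mul,
      mul_one, one_smul]
  refine ⟨fun a b hab => ?_, fun b => ⟨u • b, ?_⟩⟩
  · have : v • a = v • b := by rw [← hv, ← hv]; exact hab
    rw [← one_smul (RingLoc x) a, ← huv, mul_smul, this, ← mul_smul, huv, one_smul]
  · change (x : Λ) • u • b = b
    rw [hv, ← mul_smul, hvu, one_smul]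

theorem bijective_pow_smul_of_loc (N : Type u) [AddCommGroup N] [Module Λ N]
    [Module (RingLoc x) N] [IsScalarTower Λ (RingLoc x) N] (k : ℕ) :
    Function.Bijective fun n : N => (x : Λ) ^ k • n := by
  induction k with
  | zero => simpa using! Function.bijective_id
  | succ k ih =>
    simp only [pow_succ, mul_smul]
    exact ih.comp (bijective_smul_of_loc x N)

namespace IsLocBy

variable {x} {M M' : Type u} [AddCommGroup M] [Module Λ M] [AddCommGroup M'] [Module Λ M']
  [Module (RingLoc x) M'] [IsScalarTower Λ (RingLoc x) M'] {j : M →ₗ[Λ] M'}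

omit [Module (RingLoc x) M'] [IsScalarTower Λ (RingLoc x) M'] in
theorem injective (h : IsLocBy x j) (hx : ∀ m : M, (x : Λ) • m = 0 → m = 0) :
    Function.Injective j := by
  rw [injective_iff_map_eq_zero]
  intro m hm
  obtain ⟨k, hk⟩ := h.exists_smul_eq_zero m hm
  induction k generalizing m with
  | zero => simpa using hk
  | succ k ih =>
    rw [pow_succ, mul_smul] at hk
    exact hx _ (ih _ (by rw [map_smul, hm, smul_zero]) hk)

theorem isScalarExtension (h : IsLocBy x j) : IsScalarExtension (RingLoc x) j where
  span_range := by
    refine eq_top_iff.mpr fun y _ => ?_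
    obtain ⟨k, m, hm⟩ := h.exists_smul_eq y
    obtain ⟨r, hr⟩ := (bijective_pow_smul_of_loc x (RingLoc x) k).2 1
    have : y = r • j m := by
      apply (bijective_pow_smul_of_loc x M' k).1
      change (x : Λ) ^ k • y = (x : Λ) ^ k • r • j m
      rw [← smul_assoc, show (x : Λ) ^ k • r = 1 from hr, one_smul, hm]
    rw [this]
    exact Submodule.smul_mem _ _ (Submodule.subset_span ⟨m, rfl⟩)
  exists_lift N _ _ _ _ f := by
    have hinj (k : ℕ) := (bijective_pow_smul_of_loc x N k).1
    -- `P` is the graph of the lift: some power of `x` carries `(y, n)` to a pair `(j m, f m)`. It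
    -- is single-valued because powers of `x` act injectively on `N`, and uniqueness then gives
    -- additivity and `Λ`-linearity.
    let P (y : M') (n : N) : Prop := ∃ (k : ℕ) (m : M), (x : Λ) ^ k • y = j m ∧
      (x : Λ) ^ k • n = f m
    have hex (y : M') : ∃ n, P y n := by
      obtain ⟨k, m, hm⟩ := h.exists_smul_eq y
      obtain ⟨n, hn⟩ := (bijective_pow_smul_of_loc x N k).2 (f m)
      exact ⟨n, k, m, hm, hn⟩
    have huniq (y : M') (n n' : N) : P y n → P y n' → n = n' := by
      rintro ⟨k, m, hm, hn⟩ ⟨k', m', hm', hn'⟩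
      have : j ((x : Λ) ^ k' • m - (x : Λ) ^ k • m') = 0 := by
        rw [map_sub, map_smul, map_smul, ← hm, ← hm', smul_pow_center_comm, sub_self]
      obtain ⟨l, hl⟩ := h.exists_smul_eq_zero _ this
      have hl' := congrArg f hl
      rw [map_zero, map_smul, map_sub, map_smul, map_smul, ← hn, ← hn',
        smul_pow_center_comm x k ((x : Λ) ^ k') n, ← smul_sub, ← smul_sub] at hl'
      exact sub_eq_zero.mp (hinj k' (hinj k (hinj l (by simpa using hl'))))
    choose g hg using hex
    have hadd (y z : M') : g (y + z) = g y + g z := by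
      refine huniq _ _ _ (hg _) ?_
      obtain ⟨k, m, hm, hn⟩ := hg y
      obtain ⟨k', m', hm', hn'⟩ := hg z
      refine ⟨k + k', (x : Λ) ^ k' • m + (x : Λ) ^ k • m', ?_, ?_⟩
      · rw [map_add, map_smul, map_smul, ← hm, ← hm', smul_add, pow_add, mul_smul, mul_smul,
          smul_pow_center_comm x k ((x : Λ) ^ k') y]
      · rw [map_add, map_smul, map_smul, ← hn, ← hn', smul_add, pow_add, mul_smul, mul_smul,
          smul_pow_center_comm x k ((x : Λ) ^ k') (g y)]
    have hsmul (r : Λ) (y : M') : g (r • y) = r • g y := by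
      refine huniq _ _ _ (hg _) ?_
      obtain ⟨k, m, hm, hn⟩ := hg y
      exact ⟨k, r • m, by rw [map_smul, ← hm, smul_pow_center_comm],
        by rw [map_smul, ← hn, smul_pow_center_comm]⟩
    refine ⟨{ toFun := g, map_add' := hadd, map_smul' := fun r y => ?_ }, fun m =>
      huniq _ _ _ (hg _) ⟨0, m, by simp⟩⟩
    -- Clearing the denominator of `r` reduces `Λ_x`-linearity to `Λ`-linearity.
    obtain ⟨k, a, ha⟩ := (isLocBy_ring x).exists_smul_eq r
    rw [LinearMap.toSpanSingleton_apply] at ha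
    apply hinj k
    change (x : Λ) ^ k • g (r • y) = (x : Λ) ^ k • r • g y
    rw [← hsmul, ← smul_assoc, ← smul_assoc, ha, smul_assoc, smul_assoc, one_smul, one_smul, hsmul]

omit [Module (RingLoc x) M'] [IsScalarTower Λ (RingLoc x) M'] in
/-- A map from a finitely generated module to a localization becomes integral after multiplication
by a power of `x`. -/
theorem exists_pow_smul_eq (h : IsLocBy x j) (hx : ∀ m : M, (x : Λ) • m = 0 → m = 0)
    {A : Type u} [AddCommGroup A] [Module Λ A] [Module.Finite Λ A] (f : A →ₗ[Λ] M') :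
    ∃ (k : ℕ) (g : A →ₗ[Λ] M), ∀ a, j (g a) = (x : Λ) ^ k • f a := by
  obtain ⟨S, hS⟩ := Module.Finite.fg_top (R := Λ) (M := A)
  choose e m hm using fun a => h.exists_smul_eq (f a)
  let k := S.sup e
  let fk : A →ₗ[Λ] M' :=
    { toFun := fun a => (x : Λ) ^ k • f a
      map_add' := fun a b => by rw [map_add, smul_add]
      map_smul' := fun r a => by rw [map_smul, smul_pow_center_comm]; rfl }
  have hk (a : A) : fk a ∈ LinearMap.range j := by
    have : Submodule.span Λ (S : Set A) ≤ (LinearMap.range j).comap fk := by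
      rw [Submodule.span_le]
      intro a ha
      refine ⟨(x : Λ) ^ (k - e a) • m a, ?_⟩
      change j _ = (x : Λ) ^ k • f a
      rw [map_smul, ← hm, ← mul_smul, ← pow_add, Nat.sub_add_cancel (Finset.le_sup ha)]
    exact this (hS ▸ Submodule.mem_top)
  obtain ⟨g, hg⟩ := (IsShortExact.of_injective (h.injective hx)).exists_eq_comp_left fk
    fun a => by
      rw [Submodule.mkQ_apply, Submodule.Quotient.mk_eq_zero]
      exact hk a
  exact ⟨k, g, hg⟩

end IsLocBy

theorem IsShortExact.locBy {A A' B B' C C' : Type u} [AddCommGroup A] [Module Λ A]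
    [AddCommGroup A'] [Module Λ A'] [Module (RingLoc x) A'] [IsScalarTower Λ (RingLoc x) A']
    [AddCommGroup B] [Module Λ B] [AddCommGroup B'] [Module Λ B'] [Module (RingLoc x) B']
    [IsScalarTower Λ (RingLoc x) B'] [AddCommGroup C] [Module Λ C]
    [AddCommGroup C'] [Module Λ C'] [Module (RingLoc x) C'] [IsScalarTower Λ (RingLoc x) C']
    {i : A →ₗ[Λ] B} {p : B →ₗ[Λ] C} {jA : A →ₗ[Λ] A'} {jB : B →ₗ[Λ] B'} {jC : C →ₗ[Λ] C'}
    {i' : A' →ₗ[RingLoc x] B'} {p' : B' →ₗ[RingLoc x] C'}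
    (h : IsShortExact i p) (hA : IsLocBy x jA) (hB : IsLocBy x jB) (hC : IsLocBy x jC)
    (hi : ∀ a, i' (jA a) = jB (i a)) (hp : ∀ b, p' (jB b) = jC (p b)) : IsShortExact i' p' := by
  have hi₀ (k : ℕ) (a : A') : i' ((x : Λ) ^ k • a) = (x : Λ) ^ k • i' a :=
    map_smul (i'.restrictScalars Λ) _ _
  have hp₀ (k : ℕ) (b : B') : p' ((x : Λ) ^ k • b) = (x : Λ) ^ k • p' b :=
    map_smul (p'.restrictScalars Λ) _ _
  refine ⟨?_, fun y => ?_, fun y => ?_⟩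
  · rw [injective_iff_map_eq_zero]
    intro y hy
    obtain ⟨k, a, ha⟩ := hA.exists_smul_eq y
    obtain ⟨l, hl⟩ := hB.exists_smul_eq_zero (i a) (by rw [← hi, ← ha, hi₀, hy, smul_zero])
    rw [← map_smul, map_eq_zero_iff i h.injective] at hl
    apply (bijective_pow_smul_of_loc x A' k).1
    apply (bijective_pow_smul_of_loc x A' l).1
    simp only [ha, ← map_smul, hl, map_zero, smul_zero]
  · obtain ⟨k, b, hb⟩ := hB.exists_smul_eq y
    constructor
    · intro hy
      obtain ⟨l, hl⟩ := hC.exists_smul_eq_zero (p b) (by rw [← hp, ← hb, hp₀, hy, smul_zero])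
      rw [← map_smul, h.exact] at hl
      obtain ⟨a, ha⟩ := hl
      obtain ⟨z, hz⟩ := (bijective_pow_smul_of_loc x A' (l + k)).2 (jA a)
      refine ⟨z, (bijective_pow_smul_of_loc x B' (l + k)).1 ?_⟩
      change (x : Λ) ^ (l + k) • i' z = (x : Λ) ^ (l + k) • y
      rw [← hi₀, show (x : Λ) ^ (l + k) • z = jA a from hz, hi, ha, map_smul, ← hb, pow_add,
        mul_smul]
    · rintro ⟨z, rfl⟩
      obtain ⟨l, a, ha⟩ := hA.exists_smul_eq z
      apply (bijective_pow_smul_of_loc x C' l).1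
      change (x : Λ) ^ l • p' (i' z) = (x : Λ) ^ l • 0
      rw [← hp₀, ← hi₀, ha, hi, hp, h.apply_apply, map_zero, smul_zero]
  · obtain ⟨k, c, hc⟩ := hC.exists_smul_eq y
    obtain ⟨b, rfl⟩ := h.surjective c
    obtain ⟨z, hz⟩ := (bijective_pow_smul_of_loc x B' k).2 (jB b)
    refine ⟨z, (bijective_pow_smul_of_loc x C' k).1 ?_⟩
    change (x : Λ) ^ k • p' z = (x : Λ) ^ k • y
    rw [← hp₀, show (x : Λ) ^ k • z = jB b from hz, hp, hc]

/-- Localization of a short exact sequence. -/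
theorem IsShortExact.exists_locBy {A A' B B' C C' : Type u} [AddCommGroup A] [Module Λ A]
    [AddCommGroup A'] [Module Λ A'] [Module (RingLoc x) A'] [IsScalarTower Λ (RingLoc x) A']
    [AddCommGroup B] [Module Λ B]
    [AddCommGroup B'] [Module Λ B'] [Module (RingLoc x) B'] [IsScalarTower Λ (RingLoc x) B']
    [AddCommGroup C] [Module Λ C]
    [AddCommGroup C'] [Module Λ C'] [Module (RingLoc x) C'] [IsScalarTower Λ (RingLoc x) C']
    {i : A →ₗ[Λ] B} {p : B →ₗ[Λ] C} {jA : A →ₗ[Λ] A'} {jB : B →ₗ[Λ] B'} {jC : C →ₗ[Λ] C'}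
    (h : IsShortExact i p) (hA : IsLocBy x jA) (hB : IsLocBy x jB) (hC : IsLocBy x jC) :
    ∃ (i' : A' →ₗ[RingLoc x] B') (p' : B' →ₗ[RingLoc x] C'), (∀ a, i' (jA a) = jB (i a)) ∧
      (∀ b, p' (jB b) = jC (p b)) ∧ IsShortExact i' p' := by
  obtain ⟨i', hi'⟩ := hA.isScalarExtension.exists_map jB i
  obtain ⟨p', hp'⟩ := hB.isScalarExtension.exists_map jC p
  exact ⟨i', p', hi', hp', h.locBy x hA hB hC hi' hp'⟩

end Loc

end Central

/-! ### Behaviour of resolutions, coresolutions and Ext under the two base changes. -/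

section BaseChange

variable {Λ : Type u} [Ring Λ] {x : Subring.center Λ} {T T' : Type u} [AddCommGroup T] [Module Λ T]
  [AddCommGroup T'] [Module Λ T']

theorem IsInAdd.smul_eq_zero (hx : ∀ t : T, (x : Λ) • t = 0 → t = 0) {M : Type u} [AddCommGroup M]
    [Module Λ M] (h : IsInAdd Λ T M) (m : M) (hm : (x : Λ) • m = 0) : m = 0 := by
  obtain ⟨ι, i, p, hip⟩ := h
  have him : i m = 0 := by
    ext j
    refine hx _ ?_
    rw [← Finsupp.smul_apply, ← map_smul, hm, map_zero, Finsupp.zero_apply]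
  rw [← LinearMap.id_apply (R := Λ) m, ← hip, LinearMap.comp_apply, him, map_zero]

/-- Such a module embeds into one of `Add T`. Applied to `Λ`, this makes `x` a non-zero-divisor on
the ring; applied to the cokernels of a coresolution, it allows reducing the latter modulo `x`. -/
theorem HasFiniteAddCoresolution.smul_eq_zero (hx : ∀ t : T, (x : Λ) • t = 0 → t = 0)
    {M : Type u} [AddCommGroup M] [Module Λ M] {k : ℕ} (h : HasFiniteAddCoresolution Λ T k M)
    (m : M) (hm : (x : Λ) • m = 0) : m = 0 := by
  cases k with
  | zero => exact IsInAdd.smul_eq_zero hx h m hm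
  | succ k =>
    obtain ⟨C, D, i, p, h, hC, -⟩ := h
    rw [← map_eq_zero_iff i h.injective]
    exact hC.smul_eq_zero hx _ (by rw [← map_smul, hm, map_zero])

theorem smul_eq_zero_of_projective (hx : ∀ r : Λ, (x : Λ) • r = 0 → r = 0) {P : Type u}
    [AddCommGroup P] [Module Λ P] [Module.Projective Λ P] (m : P) (hm : (x : Λ) • m = 0) :
    m = 0 :=
  isInAdd_self_of_projective.smul_eq_zero hx m hm

theorem IsShortExact.smul_eq_zero_left {A B C : Type u} [AddCommGroup A] [Module Λ A]
    [AddCommGroup B] [Module Λ B] [AddCommGroup C] [Module Λ C] {i : A →ₗ[Λ] B} {p : B →ₗ[Λ] C}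
    (h : IsShortExact i p) (hx : ∀ b : B, (x : Λ) • b = 0 → b = 0) (a : A)
    (ha : (x : Λ) • a = 0) : a = 0 := by
  rw [← map_eq_zero_iff i h.injective]
  exact hx _ (by rw [← map_smul, ha, map_zero])

section Mod

variable [Module (RingMod x) T'] [IsScalarTower Λ (RingMod x) T'] {jT : T →ₗ[Λ] T'}

theorem HasFiniteResolution.modBy (hΛ : ∀ r : Λ, (x : Λ) • r = 0 → r = 0) {n : ℕ} :
    ∀ {M M' : Type u} [AddCommGroup M] [Module Λ M] [AddCommGroup M'] [Module Λ M']
      [Module (RingMod x) M'] [IsScalarTower Λ (RingMod x) M'] {j : M →ₗ[Λ] M'},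
      HasFiniteResolution Λ n M → (∀ m : M, (x : Λ) • m = 0 → m = 0) → IsModBy x j →
      HasFiniteResolution (RingMod x) n M' := by
  induction n with
  | zero =>
    rintro M M' _ _ _ _ _ _ j ⟨_, _⟩ - hj
    exact ⟨hj.isScalarExtension.finite, hj.isScalarExtension.projective⟩
  | succ n ih =>
    rintro M M' _ _ _ _ _ _ j ⟨K, P, i, p, h, _, _, hK⟩ hM hj
    obtain ⟨i', p', -, -, h'⟩ := h.exists_modBy x (isModBy_mkQ x K) (isModBy_mkQ x P) hj hM
    refine ⟨ModuleCat.of _ (ModMod x K), ModuleCat.of _ (ModMod x P), i', p', h',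
      (isModBy_mkQ x P).isScalarExtension.finite, (isModBy_mkQ x P).isScalarExtension.projective,
      ih hK (h.smul_eq_zero_left (smul_eq_zero_of_projective hΛ)) (isModBy_mkQ x K)⟩

theorem HasFiniteResolution.extVanishes_iff_modBy (hΛ : ∀ r : Λ, (x : Λ) • r = 0 → r = 0)
    {N : Type u} [AddCommGroup N] [Module Λ N] [Module (RingMod x) N]
    [IsScalarTower Λ (RingMod x) N] {n : ℕ} :
    ∀ {M M' : Type u} [AddCommGroup M] [Module Λ M] [AddCommGroup M'] [Module Λ M']
      [Module (RingMod x) M'] [IsScalarTower Λ (RingMod x) M'] {j : M →ₗ[Λ] M'},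
      HasFiniteResolution Λ n M → (∀ m : M, (x : Λ) • m = 0 → m = 0) → IsModBy x j →
      (ExtVanishes Λ M N ↔ ExtVanishes (RingMod x) M' N) := by
  induction n with
  | zero =>
    rintro M M' _ _ _ _ _ _ j ⟨_, _⟩ - hj
    have := hj.isScalarExtension.projective
    exact ⟨fun _ => .of_projective, fun _ => .of_projective⟩
  | succ n ih =>
    rintro M M' _ _ _ _ _ _ j ⟨K, P, i, p, h, _, _, hK⟩ hM hj
    obtain ⟨i', p', hi, -, h'⟩ := h.exists_modBy x (isModBy_mkQ x K) (isModBy_mkQ x P) hj hM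
    exact h.extVanishes_iff_extVanishes h' (isModBy_mkQ x K).isScalarExtension
      (isModBy_mkQ x P).isScalarExtension hi
      (ih hK (h.smul_eq_zero_left (smul_eq_zero_of_projective hΛ)) (isModBy_mkQ x K))

theorem HasFiniteAddCoresolution.modBy (hjT : IsModBy x jT)
    (hx : ∀ t : T, (x : Λ) • t = 0 → t = 0) {k : ℕ} :
    ∀ {M M' : Type u} [AddCommGroup M] [Module Λ M] [AddCommGroup M'] [Module Λ M']
      [Module (RingMod x) M'] [IsScalarTower Λ (RingMod x) M'] {j : M →ₗ[Λ] M'},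
      HasFiniteAddCoresolution Λ T k M → IsModBy x j →
      HasFiniteAddCoresolution (RingMod x) T' k M' := by
  induction k with
  | zero => exact fun h hj => hjT.isScalarExtension.isInAdd hj.isScalarExtension h
  | succ k ih =>
    rintro M M' _ _ _ _ _ _ j ⟨C, D, i, p, h, hC, hD⟩ hj
    obtain ⟨i', p', -, -, h'⟩ := h.exists_modBy x hj (isModBy_mkQ x C) (isModBy_mkQ x D)
      (hD.smul_eq_zero hx)
    exact ⟨ModuleCat.of _ (ModMod x C), ModuleCat.of _ (ModMod x D), i', p', h',
      hjT.isScalarExtension.isInAdd (isModBy_mkQ x C).isScalarExtension hC, ih hD (isModBy_mkQ x D)⟩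

omit [Module (RingMod x) T'] [IsScalarTower Λ (RingMod x) T'] in
theorem IsModBy.isShortExact (hjT : IsModBy x jT) (hx : ∀ t : T, (x : Λ) • t = 0 → t = 0) :
    IsShortExact (mulEnd x T) jT where
  injective := (injective_iff_map_eq_zero _).mpr hx
  exact t := (hjT.eq_zero_iff t).trans (exists_congr fun _ => eq_comm)
  surjective := hjT.surjective

end Mod

section Loc

variable [Module (RingLoc x) T'] [IsScalarTower Λ (RingLoc x) T'] {jT : T →ₗ[Λ] T'}

theorem HasFiniteResolution.locBy {n : ℕ} :
    ∀ {M M' : Type u} [AddCommGroup M] [Module Λ M] [AddCommGroup M'] [Module Λ M']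
      [Module (RingLoc x) M'] [IsScalarTower Λ (RingLoc x) M'] {j : M →ₗ[Λ] M'},
      HasFiniteResolution Λ n M → IsLocBy x j → HasFiniteResolution (RingLoc x) n M' := by
  induction n with
  | zero =>
    rintro M M' _ _ _ _ _ _ j ⟨_, _⟩ hj
    exact ⟨hj.isScalarExtension.finite, hj.isScalarExtension.projective⟩
  | succ n ih =>
    rintro M M' _ _ _ _ _ _ j ⟨K, P, i, p, h, _, _, hK⟩ hj
    obtain ⟨i', p', -, -, h'⟩ := h.exists_locBy x (isLocBy_locMk x K) (isLocBy_locMk x P) hj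
    refine ⟨ModuleCat.of _ (ModLoc x K), ModuleCat.of _ (ModLoc x P), i', p', h',
      (isLocBy_locMk x P).isScalarExtension.finite,
      (isLocBy_locMk x P).isScalarExtension.projective, ih hK (isLocBy_locMk x K)⟩

theorem HasFiniteResolution.extVanishes_iff_locBy {N : Type u} [AddCommGroup N] [Module Λ N]
    [Module (RingLoc x) N] [IsScalarTower Λ (RingLoc x) N] {n : ℕ} :
    ∀ {M M' : Type u} [AddCommGroup M] [Module Λ M] [AddCommGroup M'] [Module Λ M']
      [Module (RingLoc x) M'] [IsScalarTower Λ (RingLoc x) M'] {j : M →ₗ[Λ] M'},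
      HasFiniteResolution Λ n M → IsLocBy x j →
      (ExtVanishes Λ M N ↔ ExtVanishes (RingLoc x) M' N) := by
  induction n with
  | zero =>
    rintro M M' _ _ _ _ _ _ j ⟨_, _⟩ hj
    have := hj.isScalarExtension.projective
    exact ⟨fun _ => .of_projective, fun _ => .of_projective⟩
  | succ n ih =>
    rintro M M' _ _ _ _ _ _ j ⟨K, P, i, p, h, _, _, hK⟩ hj
    obtain ⟨i', p', hi, -, h'⟩ := h.exists_locBy x (isLocBy_locMk x K) (isLocBy_locMk x P) hj
    exact h.extVanishes_iff_extVanishes h' (isLocBy_locMk x K).isScalarExtension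
      (isLocBy_locMk x P).isScalarExtension hi (ih hK (isLocBy_locMk x K))

theorem HasFiniteAddCoresolution.locBy (hjT : IsLocBy x jT) {k : ℕ} :
    ∀ {M M' : Type u} [AddCommGroup M] [Module Λ M] [AddCommGroup M'] [Module Λ M']
      [Module (RingLoc x) M'] [IsScalarTower Λ (RingLoc x) M'] {j : M →ₗ[Λ] M'},
      HasFiniteAddCoresolution Λ T k M → IsLocBy x j →
      HasFiniteAddCoresolution (RingLoc x) T' k M' := by
  induction k with
  | zero => exact fun h hj => hjT.isScalarExtension.isInAdd hj.isScalarExtension h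
  | succ k ih =>
    rintro M M' _ _ _ _ _ _ j ⟨C, D, i, p, h, hC, hD⟩ hj
    obtain ⟨i', p', -, -, h'⟩ := h.exists_locBy x hj (isLocBy_locMk x C) (isLocBy_locMk x D)
    exact ⟨ModuleCat.of _ (ModLoc x C), ModuleCat.of _ (ModLoc x D), i', p', h',
      hjT.isScalarExtension.isInAdd (isLocBy_locMk x C).isScalarExtension hC,
      ih hD (isLocBy_locMk x D)⟩

/-- Maps into a module over `Λ_x` can be divided by powers of `x`. -/
theorem exists_pow_smul_eq_of_loc {A : Type u} [AddCommGroup A] [Module Λ A] (k : ℕ)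
    (f : A →ₗ[Λ] T') : ∃ g : A →ₗ[Λ] T', ∀ a, (x : Λ) ^ k • g a = f a := by
  have hb : Function.Bijective (mulEnd (x ^ k) T') := by
    simpa [mulEnd] using bijective_pow_smul_of_loc x T' k
  let e := LinearEquiv.ofBijective (mulEnd (x ^ k) T') hb
  refine ⟨e.symm.toLinearMap ∘ₗ f, fun a => ?_⟩
  exact e.apply_symm_apply (f a)

/-- To extend a map `K → T_x`, multiply by a power of `x` so that it lands in `T`, extend there, and
divide by that power. -/
theorem HasFiniteResolution.extVanishes_locBy (hjT : IsLocBy x jT)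
    (hx : ∀ t : T, (x : Λ) • t = 0 → t = 0) {n : ℕ} : ∀ {M : Type u} [AddCommGroup M] [Module Λ M],
      HasFiniteResolution Λ n M → ExtVanishes Λ M T → ExtVanishes Λ M T' := by
  induction n with
  | zero =>
    rintro M _ _ ⟨_, _⟩ -
    exact .of_projective
  | succ n ih =>
    rintro M _ _ ⟨K, P, i, p, h, _, _, hK⟩ hM
    rw [h.extVanishes_iff] at hM ⊢
    refine ⟨ih hK hM.1, fun f => ?_⟩
    have := hK.finite
    obtain ⟨k, g, hg⟩ := hjT.exists_pow_smul_eq hx f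
    obtain ⟨g', rfl⟩ := hM.2 g
    obtain ⟨f', hf'⟩ := exists_pow_smul_eq_of_loc (x := x) k (jT ∘ₗ g')
    refine ⟨f', LinearMap.ext fun a => (bijective_pow_smul_of_loc x T' k).1 ?_⟩
    change (x : Λ) ^ k • f' (i a) = (x : Λ) ^ k • f a
    rw [hf', ← hg]
    rfl

end Loc

end BaseChange

/-! ### Endomorphism rings of `T/xT` and `T_x`. -/

section Endomorphisms

variable {Λ : Type u} [Ring Λ] (x : Subring.center Λ) (T : Type u) [AddCommGroup T] [Module Λ T]

/-- This is Hom(T, –) applied to `0 → T → T → T/xT → 0`: an endomorphism with image in `xT` is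
divisible by `x`, and Ext¹(T, T) = 0 lifts maps `T → T/xT`. -/
theorem tiltedRingModHom_bijective (hx : ∀ t : T, (x : Λ) • t = 0 → t = 0)
    (hT : ExtVanishes Λ T T) : Function.Bijective (tiltedRingModHom x T) := by
  have hs := (isModBy_mkQ x T).isShortExact hx
  constructor
  · rw [injective_iff_map_eq_zero]
    intro f hf
    obtain ⟨f, rfl⟩ := Ideal.Quotient.mk_surjective f
    obtain ⟨g, hg⟩ := hs.exists_eq_comp_left f.unop fun t =>
      LinearMap.congr_fun (MulOpposite.op_injective hf) (Submodule.mkQ _ t)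
    rw [Ideal.Quotient.eq_zero_iff_mem, Ideal.mem_span_singleton']
    exact ⟨MulOpposite.op g, MulOpposite.unop_injective (LinearMap.ext hg)⟩
  · intro ψ
    obtain ⟨φ, hφ⟩ := hs.lift hT ((ψ.unop.restrictScalars Λ) ∘ₗ
      (Submodule.mkQ _ : T →ₗ[Λ] ModMod x T))
    refine ⟨Ideal.Quotient.mk _ (MulOpposite.op φ), MulOpposite.unop_injective
      (LinearMap.ext fun t => ?_)⟩
    obtain ⟨t, rfl⟩ := Submodule.Quotient.mk_surjective _ t
    exact LinearMap.congr_fun hφ t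

theorem tiltedRingLocHom_locMk (f : TiltedRing Λ T) :
    tiltedRingLocHom x T (locMk (bullet x T) _ f) = tiltedRingToLoc x T f :=
  OreLocalization.universalHom_commutes _ _ _

theorem tiltedRingToLoc_bullet_apply (y : ModLoc x T) :
    (tiltedRingToLoc x T (bullet x T)).unop y = (x : Λ) • y := by
  obtain ⟨l, t, ht⟩ := (isLocBy_locMk x T).exists_smul_eq y
  apply (bijective_pow_smul_of_loc x (ModLoc x T) l).1
  change (x : Λ) ^ l • (((tiltedRingToLoc x T (bullet x T)).unop).restrictScalars Λ) y =
    (x : Λ) ^ l • (x : Λ) • y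
  rw [← map_smul, ht, ← smul_pow_center_comm, ht, ← map_smul]
  rfl

theorem tiltedRingToLoc_bullet_pow_apply (k : ℕ) (y : ModLoc x T) :
    (tiltedRingToLoc x T ((bullet x T : TiltedRing Λ T) ^ k)).unop y = (x : Λ) ^ k • y := by
  induction k with
  | zero => rw [pow_zero, pow_zero, map_one, one_smul]; rfl
  | succ k ih =>
    rw [pow_succ, map_mul, MulOpposite.unop_mul, Module.End.mul_apply, ih,
      tiltedRingToLoc_bullet_apply, pow_succ', mul_smul]

/-- Finite generation of `T` gives one power of `x` that makes an endomorphism of `T_x` integral on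
`T`; torsion-freeness makes `T → T_x` injective. -/
theorem tiltedRingLocHom_bijective [Module.Finite Λ T] (hx : ∀ t : T, (x : Λ) • t = 0 → t = 0) :
    Function.Bijective (tiltedRingLocHom x T) := by
  have hj := isLocBy_locMk x T
  have hΓ := isLocBy_locMk (bullet x T) (TiltedRing Λ T)
  -- An equation `x_•^k F = f` in the localized ring, carried to the endomorphisms of `T_x`; there
  -- the image of `x_•^k` is a unit acting as `x^k`.
  have hH (k : ℕ) (F : RingLoc (bullet x T)) (f : TiltedRing Λ T)
      (h : (bullet x T : TiltedRing Λ T) ^ k • F = locMk (bullet x T) _ f) :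
      tiltedRingToLoc x T ((bullet x T : TiltedRing Λ T) ^ k) * tiltedRingLocHom x T F =
        tiltedRingToLoc x T f := by
    rw [← tiltedRingLocHom_locMk, ← tiltedRingLocHom_locMk, ← h, ← map_mul]
    congr 1
    exact OreLocalization.oreDiv_one_smul _ _
  constructor
  · rw [injective_iff_map_eq_zero]
    intro F hF
    obtain ⟨k, f, hf⟩ := hΓ.exists_smul_eq F
    have h0 := hH k F f hf
    rw [hF, mul_zero] at h0
    have : f = 0 := by
      refine MulOpposite.unop_injective (LinearMap.ext fun t => hj.injective hx ?_)
      rw [MulOpposite.unop_zero, LinearMap.zero_apply, map_zero]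
      exact (LinearMap.congr_fun (MulOpposite.op_injective h0) (locMk x T t)).symm
    rw [this, map_zero] at hf
    exact (bijective_pow_smul_of_loc (bullet x T) (RingLoc (bullet x T)) k).1
      (hf.trans (smul_zero _).symm)
  · intro ψ
    obtain ⟨k, φ, hφ⟩ := hj.exists_pow_smul_eq hx ((ψ.unop.restrictScalars Λ) ∘ₗ locMk x T)
    obtain ⟨F, hF⟩ := (bijective_pow_smul_of_loc (bullet x T) (RingLoc (bullet x T)) k).2
      (locMk (bullet x T) _ (MulOpposite.op φ))
    refine ⟨F, ?_⟩
    have hu : IsUnit (tiltedRingToLoc x T ((bullet x T : TiltedRing Λ T) ^ k)) :=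
      tiltedRingToLoc_isUnit x T ⟨_, k, rfl⟩
    refine hu.mul_left_cancel ((hH k F _ hF).trans ?_)
    refine MulOpposite.unop_injective (hj.isScalarExtension.hom_ext fun t => ?_)
    change locMk x T (φ t) = ψ.unop ((tiltedRingToLoc x T ((bullet x T : TiltedRing Λ T) ^ k)).unop
      (locMk x T t))
    rw [hφ, tiltedRingToLoc_bullet_pow_apply]
    exact ((ψ.unop.restrictScalars Λ).map_smul _ _).symm

end Endomorphisms

/-! ### Classical tilting modules under base change. -/

section ClassicalTilting

variable {Λ : Type u} [Ring Λ] {T : Type u} [AddCommGroup T] [Module Λ T] {n : ℕ}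

theorem IsClassicalTilting.hasFiniteResolution (h : IsClassicalTilting Λ T n) :
    HasFiniteResolution Λ n T :=
  h.stronglyFinitelyPresented.hasResolution.hasFiniteResolution h.projectiveDimension_le

theorem IsClassicalTilting.extVanishes (h : IsClassicalTilting Λ T n) : ExtVanishes Λ T T :=
  ExtVanishes.retract_right (h.ext_eq_zero PUnit) (Finsupp.lsingle PUnit.unit)
    (Finsupp.lapply PUnit.unit) (LinearMap.ext fun t => by simp)

theorem IsClassicalTilting.of_hasFiniteResolution (h : HasFiniteResolution Λ n T)
    (hT : ExtVanishes Λ T T) {k : ℕ} (hk : HasFiniteAddCoresolution Λ T k Λ) :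
    IsClassicalTilting Λ T n where
  projectiveDimension_le := h.hasProjectiveDimensionLE
  ext_eq_zero ι := h.extVanishes_finsupp ι hT
  coresolution := hasAddCoresolution_iff.mpr ⟨k, hk⟩
  stronglyFinitelyPresented := h.hasResolution.stronglyFinitelyPresented

variable (x : Subring.center Λ)

theorem IsClassicalTilting.modBy (h : IsClassicalTilting Λ T n)
    (hx : ∀ t : T, (x : Λ) • t = 0 → t = 0) :
    IsClassicalTilting (RingMod x) (ModMod x T) n := by
  obtain ⟨k, hk⟩ := hasAddCoresolution_iff.mp h.coresolution
  have hr := h.hasFiniteResolution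
  have hj := isModBy_mkQ x T
  have hΛ := hk.smul_eq_zero hx
  refine .of_hasFiniteResolution (hr.modBy hΛ hx hj)
    ((hr.extVanishes_iff_modBy hΛ hx hj).mp ?_) (hk.modBy hj hx (isModBy_ring x))
  -- Ext in degree `i` from `T` to `T/xT` lies between Ext(T, T) in degrees `i` and `i + 1`.
  exact (hj.isShortExact hx).extVanishes_coker h.extVanishes h.extVanishes

theorem IsClassicalTilting.locBy (h : IsClassicalTilting Λ T n)
    (hx : ∀ t : T, (x : Λ) • t = 0 → t = 0) :
    IsClassicalTilting (RingLoc x) (ModLoc x T) n := by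
  obtain ⟨k, hk⟩ := hasAddCoresolution_iff.mp h.coresolution
  have hr := h.hasFiniteResolution
  have hj := isLocBy_locMk x T
  exact .of_hasFiniteResolution (hr.locBy hj)
    ((hr.extVanishes_iff_locBy hj).mp (hr.extVanishes_locBy hj hx h.extVanishes))
    (hk.locBy hj (isLocBy_ring x))

end ClassicalTilting

/-- The quotient `H/H'` is finitely generated, so a single power of `x` kills it, while `x` maps it
onto itself; hence it is zero. -/
theorem Submodule.eq_top_of_forall_pow_smul_mem {R H : Type*} [CommRing R] [AddCommGroup H]
    [Module R H] [Module.Finite R H] (x : R) (H' : Submodule R H)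
    (hpow : ∀ h, ∃ k : ℕ, x ^ k • h ∈ H') (hdiv : ∀ h, ∃ h' ∈ H', ∃ h₁, h = h' + x • h₁) :
    H' = ⊤ := by
  obtain ⟨S, hS⟩ := Module.Finite.fg_top (R := R) (M := H)
  choose e he using hpow
  let k := S.sup e
  have hk (h : H) : x ^ k • h ∈ H' := by
    have : Submodule.span R (S : Set H) ≤ H'.comap (LinearMap.lsmul R H (x ^ k)) := by
      rw [Submodule.span_le]
      intro a ha
      change x ^ k • a ∈ H'
      rw [← Nat.sub_add_cancel (show e a ≤ k from Finset.le_sup ha), pow_add, mul_smul]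
      exact H'.smul_mem _ (he a)
    exact this (hS ▸ Submodule.mem_top)
  have hl (l : ℕ) : ∀ h, ∃ h' ∈ H', ∃ h₁, h = h' + x ^ l • h₁ := by
    induction l with
    | zero => exact fun h => ⟨0, H'.zero_mem, h, by simp⟩
    | succ l ih =>
      intro h
      obtain ⟨h', hh', h₁, rfl⟩ := ih h
      obtain ⟨h'', hh'', h₂, rfl⟩ := hdiv h₁
      exact ⟨h' + x ^ l • h'', H'.add_mem hh' (H'.smul_mem _ hh''), h₂,
        by rw [smul_add, pow_succ, mul_smul, add_assoc]⟩
  refine eq_top_iff.mpr fun h _ => ?_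
  obtain ⟨h', hh', h₁, rfl⟩ := hl k h
  exact H'.add_mem hh' (hk h₁)

/-! ### Descent of Ext vanishing and projective dimension over a noetherian center. -/

section NoetherianCenter

variable {Λ : Type u} [Ring Λ] {x : Subring.center Λ}

/-- Makes Hom over `Λ` a module over the center. -/
theorem smulCommClass_center (M : Type u) [AddCommGroup M] [Module Λ M] :
    SMulCommClass Λ (Subring.center Λ) M :=
  ⟨fun r z m => smul_center_comm z r m⟩

attribute [local instance] smulCommClass_center

variable [IsNoetherianRing (Subring.center Λ)] [Module.Finite (Subring.center Λ) Λ]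

/-- Evaluation at finitely many generators embeds Hom(M, N) into a finite power of `N`, which is
noetherian over the center. -/
theorem finite_linearMap_center (M N : Type u) [AddCommGroup M] [Module Λ M] [AddCommGroup N]
    [Module Λ N] [Module.Finite Λ M] [Module.Finite Λ N] :
    Module.Finite (Subring.center Λ) (M →ₗ[Λ] N) := by
  obtain ⟨S, hS⟩ := Module.Finite.fg_top (R := Λ) (M := M)
  have : Module.Finite (Subring.center Λ) N := Module.Finite.trans Λ N
  let ev : (M →ₗ[Λ] N) →ₗ[Subring.center Λ] (S → N) :=
    { toFun := fun f s => f s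
      map_add' := fun _ _ => rfl
      map_smul' := fun _ _ => rfl }
  have hev : Function.Injective ev := fun f g hfg =>
    LinearMap.ext_on hS fun m hm => congrFun hfg ⟨m, hm⟩
  exact Module.Finite.of_injective ev hev

/-- A map extends if it extends modulo `x` and after inverting `x`. -/
theorem exists_comp_eq_of_mod_loc {K P N N' N'' : Type u} [AddCommGroup K] [Module Λ K]
    [AddCommGroup P] [Module Λ P] [AddCommGroup N] [Module Λ N] [AddCommGroup N'] [Module Λ N']
    [AddCommGroup N''] [Module Λ N''] [Module.Finite Λ K] [Module.Finite Λ P] [Module.Finite Λ N]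
    (hx : ∀ m : N, (x : Λ) • m = 0 → m = 0) {j' : N →ₗ[Λ] N'} (hj' : IsModBy x j')
    {j'' : N →ₗ[Λ] N''} (hj'' : IsLocBy x j'') (i : K →ₗ[Λ] P)
    (hmod : ∀ f : K →ₗ[Λ] N, ∃ g : P →ₗ[Λ] N, ∀ k, j' (g (i k)) = j' (f k))
    (hloc : ∀ f : K →ₗ[Λ] N'', ∃ g : P →ₗ[Λ] N'', g ∘ₗ i = f) (f : K →ₗ[Λ] N) :
    ∃ g : P →ₗ[Λ] N, g ∘ₗ i = f := by
  have := finite_linearMap_center (Λ := Λ) K N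
  let ρ : (P →ₗ[Λ] N) →ₗ[Subring.center Λ] (K →ₗ[Λ] N) :=
    { toFun := fun g => g ∘ₗ i
      map_add' := fun _ _ => rfl
      map_smul' := fun _ _ => rfl }
  -- The torsion criterion is applied to the extendable maps inside Hom(K, N). Localization makes
  -- `x^k f` extendable, and `hmod` makes `f` extendable up to a multiple of `x`.
  suffices h : LinearMap.range ρ = ⊤ from LinearMap.range_eq_top.mp h f
  refine Submodule.eq_top_of_forall_pow_smul_mem x _ (fun f => ?_) fun f => ?_
  · obtain ⟨g, hg⟩ := hloc (j'' ∘ₗ f)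
    obtain ⟨k, g', hg'⟩ := hj''.exists_pow_smul_eq hx g
    refine ⟨k, g', LinearMap.ext fun a => hj''.injective hx ?_⟩
    change j'' (g' (i a)) = j'' ((x : Λ) ^ k • f a)
    rw [hg', map_smul]
    exact congrArg _ (LinearMap.congr_fun hg a)
  · obtain ⟨g, hg⟩ := hmod f
    obtain ⟨f₁, hf₁⟩ := (hj'.isShortExact hx).exists_eq_comp_left (f - g ∘ₗ i) fun a => by
      rw [LinearMap.sub_apply, map_sub, LinearMap.comp_apply, hg, sub_self]
    refine ⟨ρ g, ⟨g, rfl⟩, f₁, LinearMap.ext fun a => ?_⟩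
    change f a = g (i a) + (x : Λ) • f₁ a
    exact (sub_eq_iff_eq_add'.mp (hf₁ a).symm)

theorem exists_comp_eq_of_mod_loc_of_projective {K P N N' N'' : Type u} [AddCommGroup K]
    [Module Λ K] [AddCommGroup P] [Module Λ P] [AddCommGroup N] [Module Λ N] [AddCommGroup N']
    [Module Λ N'] [AddCommGroup N''] [Module Λ N''] [Module.Finite Λ K] [Module.Finite Λ P]
    [Module.Projective Λ P] [Module.Finite Λ N]
    (hx : ∀ m : N, (x : Λ) • m = 0 → m = 0) {j' : N →ₗ[Λ] N'} (hj' : IsModBy x j')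
    {j'' : N →ₗ[Λ] N''} (hj'' : IsLocBy x j'') (i : K →ₗ[Λ] P)
    (hmod : ∀ f : K →ₗ[Λ] N', ∃ g : P →ₗ[Λ] N', g ∘ₗ i = f)
    (hloc : ∀ f : K →ₗ[Λ] N'', ∃ g : P →ₗ[Λ] N'', g ∘ₗ i = f) (f : K →ₗ[Λ] N) :
    ∃ g : P →ₗ[Λ] N, g ∘ₗ i = f := by
  refine exists_comp_eq_of_mod_loc hx hj' hj'' i (fun f => ?_) hloc f
  obtain ⟨g, hg⟩ := hmod (j' ∘ₗ f)
  obtain ⟨g', hg'⟩ := Module.projective_lifting_property j' g hj'.surjective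
  exact ⟨g', fun k => (LinearMap.congr_fun hg' (i k)).trans (LinearMap.congr_fun hg k)⟩

theorem HasFiniteResolution.extVanishes_of_mod_loc {N N' N'' : Type u} [AddCommGroup N] [Module Λ N]
    [AddCommGroup N'] [Module Λ N'] [AddCommGroup N''] [Module Λ N''] [Module.Finite Λ N]
    (hx : ∀ m : N, (x : Λ) • m = 0 → m = 0) {j' : N →ₗ[Λ] N'} (hj' : IsModBy x j')
    {j'' : N →ₗ[Λ] N''} (hj'' : IsLocBy x j'') {n : ℕ} :
    ∀ {M : Type u} [AddCommGroup M] [Module Λ M], HasFiniteResolution Λ n M →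
      ExtVanishes Λ M N' → ExtVanishes Λ M N'' → ExtVanishes Λ M N := by
  induction n with
  | zero =>
    rintro M _ _ ⟨_, _⟩ - -
    exact .of_projective
  | succ n ih =>
    rintro M _ _ ⟨K, P, i, p, h, _, _, hK⟩ hM' hM''
    have := hK.finite
    rw [h.extVanishes_iff] at hM' hM'' ⊢
    exact ⟨ih hK hM'.1 hM''.1,
      exists_comp_eq_of_mod_loc_of_projective hx hj' hj'' i hM'.2 hM''.2⟩

omit [IsNoetherianRing (Subring.center Λ)] [Module.Finite (Subring.center Λ) Λ] in
theorem IsShortExact.projective_of_retraction {A B C : Type u} [AddCommGroup A] [Module Λ A]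
    [AddCommGroup B] [Module Λ B] [AddCommGroup C] [Module Λ C] {i : A →ₗ[Λ] B} {p : B →ₗ[Λ] C}
    (h : IsShortExact i p) [Module.Projective Λ B] {r : B →ₗ[Λ] A} (hr : r ∘ₗ i = LinearMap.id) :
    Module.Projective Λ C := by
  obtain ⟨s, hs⟩ := h.exists_eq_comp_right (LinearMap.id - i ∘ₗ r) fun a => by
    have : r (i a) = a := LinearMap.congr_fun hr a
    simp [this]
  refine .of_split s p (LinearMap.ext fun c => ?_)
  obtain ⟨b, rfl⟩ := h.surjective c
  rw [LinearMap.comp_apply, hs, LinearMap.sub_apply, map_sub, LinearMap.comp_apply, h.apply_apply,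
    sub_zero]
  rfl

/-- Passing to syzygies reduces to `n = 0`. There the reduced and localized sequences have
projective cokernel, so maps out of `K'` and `K''` extend; hence the identity of `K` extends to `P`
and `0 → K → P → M → 0` splits. -/
theorem HasResolution.hasFiniteResolution_of_mod_loc
    (hΛ : ∀ r : Λ, (x : Λ) • r = 0 → r = 0) {n : ℕ} :
    ∀ {M M' M'' : Type u} [AddCommGroup M] [Module Λ M] [AddCommGroup M'] [Module Λ M']
      [Module (RingMod x) M'] [IsScalarTower Λ (RingMod x) M'] [AddCommGroup M''] [Module Λ M'']
      [Module (RingLoc x) M''] [IsScalarTower Λ (RingLoc x) M''] {j' : M →ₗ[Λ] M'}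
      {j'' : M →ₗ[Λ] M''}, HasResolution Λ M → (∀ m : M, (x : Λ) • m = 0 → m = 0) →
      IsModBy x j' → IsLocBy x j'' →
      HasProjectiveDimensionLE (ModuleCat.of (RingMod x) M') n →
      HasProjectiveDimensionLE (ModuleCat.of (RingLoc x) M'') n → HasFiniteResolution Λ n M := by
  induction n with
  | zero =>
    intro M M' M'' _ _ _ _ _ _ _ _ _ _ j' j'' hM hx hj' hj'' hd' hd''
    refine ⟨hM.finite, ?_⟩
    obtain ⟨K, P, i, p, h, _, _, hK⟩ := hM.exists_isShortExact
    have := hK.finite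
    have := projective_of_hasProjectiveDimensionLE_zero hd'
    have := projective_of_hasProjectiveDimensionLE_zero hd''
    obtain ⟨i', p', hi', -, h'⟩ := h.exists_modBy x (isModBy_mkQ x K) (isModBy_mkQ x P) hj' hx
    obtain ⟨i'', p'', hi'', -, h''⟩ :=
      h.exists_locBy x (isLocBy_locMk x K) (isLocBy_locMk x P) hj''
    obtain ⟨r, hr⟩ := exists_comp_eq_of_mod_loc_of_projective
      (h.smul_eq_zero_left (smul_eq_zero_of_projective hΛ)) (isModBy_mkQ x K) (isLocBy_locMk x K)
      i (fun f => by
        obtain ⟨f', hf'⟩ := (isModBy_mkQ x K).isScalarExtension.exists_lift _ f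
        obtain ⟨g, rfl⟩ := h'.extend .of_projective f'
        refine ⟨g.restrictScalars Λ ∘ₗ Submodule.mkQ _, LinearMap.ext fun a => ?_⟩
        rw [← hf']
        exact congrArg g (hi' a).symm) (fun f => by
        obtain ⟨f', hf'⟩ := (isLocBy_locMk x K).isScalarExtension.exists_lift _ f
        obtain ⟨g, rfl⟩ := h''.extend .of_projective f'
        refine ⟨g.restrictScalars Λ ∘ₗ locMk x P, LinearMap.ext fun a => ?_⟩
        rw [← hf']
        exact congrArg g (hi'' a).symm) LinearMap.id
    exact h.projective_of_retraction hr
  | succ n ih =>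
    intro M M' M'' _ _ _ _ _ _ _ _ _ _ j' j'' hM hx hj' hj'' hd' hd''
    obtain ⟨K, P, i, p, h, _, _, hK⟩ := hM.exists_isShortExact
    obtain ⟨i', p', -, -, h'⟩ := h.exists_modBy x (isModBy_mkQ x K) (isModBy_mkQ x P) hj' hx
    obtain ⟨i'', p'', -, -, h''⟩ :=
      h.exists_locBy x (isLocBy_locMk x K) (isLocBy_locMk x P) hj''
    have := (isModBy_mkQ x P).isScalarExtension.projective
    have := (isLocBy_locMk x P).isScalarExtension.projective
    exact ⟨K, P, i, p, h, ‹_›, ‹_›, ih hK (h.smul_eq_zero_left (smul_eq_zero_of_projective hΛ))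
      (isModBy_mkQ x K) (isLocBy_locMk x K) ((h'.hasProjectiveDimensionLE_iff n).mp hd')
      ((h''.hasProjectiveDimensionLE_iff n).mp hd'')⟩

/-- The coordinates of `f` generate Hom(M, T) over the center, and central scalars pass through
composition with `f`. -/
theorem exists_finite_approx (M T : Type u) [AddCommGroup M] [Module Λ M] [AddCommGroup T]
    [Module Λ T] [Module.Finite Λ M] [Module.Finite Λ T] :
    ∃ (ι : Type u) (_ : Finite ι) (f : M →ₗ[Λ] (ι →₀ T)),
      ∀ g : M →ₗ[Λ] T, ∃ h : (ι →₀ T) →ₗ[Λ] T, h ∘ₗ f = g := by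
  have := finite_linearMap_center (Λ := Λ) M T
  obtain ⟨S, hS⟩ := Module.Finite.fg_top (R := Subring.center Λ) (M := M →ₗ[Λ] T)
  refine ⟨S, inferInstance, (Finsupp.linearEquivFunOnFinite Λ T S).symm.toLinearMap ∘ₗ
    LinearMap.pi fun s => s.1, fun g => ?_⟩
  have hg : g ∈ Submodule.span (Subring.center Λ) (S : Set (M →ₗ[Λ] T)) := hS ▸ Submodule.mem_top
  induction hg using Submodule.span_induction with
  | mem s hs => exact ⟨Finsupp.lapply ⟨s, hs⟩, LinearMap.ext fun m => by simp⟩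
  | zero => exact ⟨0, LinearMap.zero_comp _⟩
  | add a b _ _ ha hb =>
    obtain ⟨a, rfl⟩ := ha
    obtain ⟨b, rfl⟩ := hb
    exact ⟨a + b, LinearMap.add_comp _ _ _⟩
  | smul z a _ ha =>
    obtain ⟨a, rfl⟩ := ha
    exact ⟨z • a, rfl⟩

end NoetherianCenter

/-! ### Left approximations under base change. -/

section Approximations

variable {Λ : Type u} [Ring Λ] {x : Subring.center Λ} {M N T : Type u} [AddCommGroup M] [Module Λ M]
  [AddCommGroup N] [Module Λ N] [AddCommGroup T] [Module Λ T] [Module.Finite Λ M]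
  (hx : ∀ t : T, (x : Λ) • t = 0 → t = 0) {f : M →ₗ[Λ] N}
  (hf : ∀ g : M →ₗ[Λ] T, ∃ h : N →ₗ[Λ] T, h ∘ₗ f = g)
  {M' N' T' : Type u} [AddCommGroup M'] [Module Λ M'] [AddCommGroup N'] [Module Λ N']
  [AddCommGroup T'] [Module Λ T']

include hx hf

/-- Ext¹(M, T) = 0 lifts a map `M' → T'` to `M → T`, which factors through `f`. Finite generation
passes from one copy of `T'` to arbitrary sums. -/
theorem isLeftAddApprox_modBy (hM : ExtVanishes Λ M T)
    [Module (RingMod x) M'] [IsScalarTower Λ (RingMod x) M'] [Module (RingMod x) N']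
    [IsScalarTower Λ (RingMod x) N'] [Module (RingMod x) T'] [IsScalarTower Λ (RingMod x) T']
    {jM : M →ₗ[Λ] M'} {jN : N →ₗ[Λ] N'} {jT : T →ₗ[Λ] T'}
    (hjM : IsModBy x jM) (hjN : IsModBy x jN) (hjT : IsModBy x jT)
    {f' : M' →ₗ[RingMod x] N'} (hf' : ∀ m, f' (jM m) = jN (f m)) : IsLeftAddApprox T' f' := by
  intro ι g
  have := hjM.isScalarExtension.finite
  refine exists_comp_eq_finsupp (fun g => ?_) g
  obtain ⟨g₀, hg₀⟩ := (hjT.isShortExact hx).lift hM (g.restrictScalars Λ ∘ₗ jM)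
  obtain ⟨h₀, rfl⟩ := hf g₀
  obtain ⟨h, hh⟩ := hjN.isScalarExtension.exists_map jT h₀
  refine ⟨h, hjM.isScalarExtension.hom_ext fun m => ?_⟩
  rw [LinearMap.comp_apply, hf', hh]
  exact LinearMap.congr_fun hg₀ m

/-- Clearing denominators takes the place of the Ext condition: multiply into `T`, factor through
`f`, divide again. -/
theorem isLeftAddApprox_locBy
    [Module (RingLoc x) M'] [IsScalarTower Λ (RingLoc x) M'] [Module (RingLoc x) N']
    [IsScalarTower Λ (RingLoc x) N'] [Module (RingLoc x) T'] [IsScalarTower Λ (RingLoc x) T']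
    {jM : M →ₗ[Λ] M'} {jN : N →ₗ[Λ] N'} {jT : T →ₗ[Λ] T'}
    (hjM : IsLocBy x jM) (hjN : IsLocBy x jN) (hjT : IsLocBy x jT)
    {f' : M' →ₗ[RingLoc x] N'} (hf' : ∀ m, f' (jM m) = jN (f m)) : IsLeftAddApprox T' f' := by
  intro ι g
  have := hjM.isScalarExtension.finite
  refine exists_comp_eq_finsupp (fun g => ?_) g
  obtain ⟨k, g₀, hg₀⟩ := hjT.exists_pow_smul_eq hx (g.restrictScalars Λ ∘ₗ jM)
  obtain ⟨h₀, rfl⟩ := hf g₀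
  obtain ⟨h₁, hh₁⟩ := exists_pow_smul_eq_of_loc (x := x) k (jT ∘ₗ h₀)
  obtain ⟨h, hh⟩ := hjN.isScalarExtension.exists_lift T' h₁
  refine ⟨h, hjM.isScalarExtension.hom_ext fun m => (bijective_pow_smul_of_loc x T' k).1 ?_⟩
  change (x : Λ) ^ k • h (f' (jM m)) = (x : Λ) ^ k • g (jM m)
  rw [hf', hh, hh₁]
  exact hg₀ m

end Approximations

/-! ### Descent of coresolutions and of classical tilting modules. -/

section Coresolution

variable {Λ : Type u} [Ring Λ] {x : Subring.center Λ} [IsNoetherianRing (Subring.center Λ)]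
  [Module.Finite (Subring.center Λ) Λ] {T T' T'' : Type u} [AddCommGroup T] [Module Λ T]
  [AddCommGroup T'] [Module Λ T'] [Module (RingMod x) T'] [IsScalarTower Λ (RingMod x) T']
  [AddCommGroup T''] [Module Λ T''] [Module (RingLoc x) T''] [IsScalarTower Λ (RingLoc x) T'']
  {jT' : T →ₗ[Λ] T'} {jT'' : T →ₗ[Λ] T''}

/-- The hypotheses on `M` (finitely generated, `x`-torsion-free, no higher Ext into `T`) are those
inherited by the cokernel of a finite approximation, so the induction on `k` continues with that
cokernel. -/
theorem HasFiniteAddCoresolution.of_mod_loc (hΛ : ∀ r : Λ, (x : Λ) • r = 0 → r = 0)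
    (hx : ∀ t : T, (x : Λ) • t = 0 → t = 0) {n : ℕ} (hr : HasFiniteResolution Λ n T)
    (hT : ExtVanishes Λ T T) (hjT' : IsModBy x jT') (hjT'' : IsLocBy x jT'')
    (hT' : ∀ ι : Type u, ExtVanishes (RingMod x) T' (ι →₀ T'))
    (hT'' : ∀ ι : Type u, ExtVanishes (RingLoc x) T'' (ι →₀ T'')) {k : ℕ} :
    ∀ {M M' M'' : Type u} [AddCommGroup M] [Module Λ M] [AddCommGroup M'] [Module Λ M']
      [Module (RingMod x) M'] [IsScalarTower Λ (RingMod x) M'] [AddCommGroup M''] [Module Λ M'']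
      [Module (RingLoc x) M''] [IsScalarTower Λ (RingLoc x) M''] {j' : M →ₗ[Λ] M'}
      {j'' : M →ₗ[Λ] M''}, Module.Finite Λ M → (∀ m : M, (x : Λ) • m = 0 → m = 0) →
      ExtVanishes Λ M T → IsModBy x j' → IsLocBy x j'' →
      HasFiniteAddCoresolution (RingMod x) T' k M' →
      HasFiniteAddCoresolution (RingLoc x) T'' k M'' → HasFiniteAddCoresolution Λ T k M := by
  have := hr.finite
  induction k with
  | zero =>
    intro M M' M'' _ _ _ _ _ _ _ _ _ _ j' j'' _ hM hMT hj' hj'' hM' hM''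
    obtain ⟨ι, _, f, hf⟩ := exists_finite_approx (Λ := Λ) M T
    have hN' := isModBy_mkQ x (ι →₀ T)
    have hN'' := isLocBy_locMk x (ι →₀ T)
    obtain ⟨f', hf'⟩ := hj'.isScalarExtension.exists_map
      (Submodule.mkQ _ : (ι →₀ T) →ₗ[Λ] ModMod x (ι →₀ T)) f
    obtain ⟨f'', hf''⟩ := hj''.isScalarExtension.exists_map (locMk x (ι →₀ T)) f
    obtain ⟨r', hr'⟩ := (isLeftAddApprox_modBy hx hf hMT hj' hN' hjT' hf').exists_comp_eq hM'
      LinearMap.id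
    obtain ⟨r'', hr''⟩ := (isLeftAddApprox_locBy hx hf hj'' hN'' hjT'' hf'').exists_comp_eq hM''
      LinearMap.id
    -- Since `T^ι` need not be projective, this vanishing is what lifts maps `T^ι → M/xM` to `M`
    -- when the retraction of `f` is built.
    have hTM : ExtVanishes Λ T M := hr.extVanishes_of_mod_loc hM hj' hj''
      ((hr.extVanishes_iff_modBy hΛ hx hjT').mpr
        (IsInAdd.extVanishes hT' (isInAdd_self _ _) hM'))
      ((hr.extVanishes_iff_locBy hjT'').mpr (IsInAdd.extVanishes hT'' (isInAdd_self _ _) hM''))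
    obtain ⟨r, hr⟩ := exists_comp_eq_of_mod_loc hM hj' hj'' f (fun g => by
      obtain ⟨g', hg'⟩ := hj'.isScalarExtension.exists_map j' g
      obtain ⟨h, hh⟩ := (hj'.isShortExact hM).lift (hTM.finsupp_left ι)
        ((g' ∘ₗ r').restrictScalars Λ ∘ₗ Submodule.mkQ _)
      refine ⟨h, fun m => (LinearMap.congr_fun hh (f m)).trans ?_⟩
      change g' (r' (Submodule.mkQ _ (f m))) = j' (g m)
      rw [← hf', ← hg']
      exact congrArg g' (LinearMap.congr_fun hr' (j' m))) (fun g => by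
      obtain ⟨g', hg'⟩ := hj''.isScalarExtension.exists_lift M'' g
      refine ⟨(g' ∘ₗ r'').restrictScalars Λ ∘ₗ locMk x (ι →₀ T), LinearMap.ext fun m => ?_⟩
      change g' (r'' (locMk x _ (f m))) = g m
      rw [← hf'', ← hg']
      exact congrArg g' (LinearMap.congr_fun hr'' (j'' m))) LinearMap.id
    exact (isInAdd_finsupp Λ T ι).retract f r hr
  | succ k ih =>
    intro M M' M'' _ _ _ _ _ _ _ _ _ _ j' j'' _ hM hMT hj' hj'' hM' hM''
    obtain ⟨ι, _, f, hf⟩ := exists_finite_approx (Λ := Λ) M T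
    have hN' := isModBy_mkQ x (ι →₀ T)
    have hN'' := isLocBy_locMk x (ι →₀ T)
    have hA' := hjT'.isScalarExtension.isInAdd hN'.isScalarExtension (isInAdd_finsupp Λ T ι)
    have hA'' := hjT''.isScalarExtension.isInAdd hN''.isScalarExtension (isInAdd_finsupp Λ T ι)
    -- Kept general in `f'`: it is needed first to show that the cokernel is torsion-free, then for
    -- the map from the reduced sequence, whose exactness depends on that.
    have hinj' {f' : M' →ₗ[RingMod x] ModMod x (ι →₀ T)}
        (hf' : ∀ m, f' (j' m) = Submodule.mkQ _ (f m)) := hM'.of_isLeftAddApprox hT' hA'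
      (isLeftAddApprox_modBy hx hf hMT hj' hN' hjT' hf')
    have hinj'' {f'' : M'' →ₗ[RingLoc x] ModLoc x (ι →₀ T)}
        (hf'' : ∀ m, f'' (j'' m) = locMk x _ (f m)) := hM''.of_isLeftAddApprox hT'' hA''
      (isLeftAddApprox_locBy hx hf hj'' hN'' hjT'' hf'')
    have hfi : Function.Injective f := by
      rw [injective_iff_map_eq_zero]
      intro m hm
      obtain ⟨f'', hf''⟩ := hj''.isScalarExtension.exists_map (locMk x (ι →₀ T)) f
      refine hj''.injective hM ((hinj'' hf'').1 ?_)
      rw [hf'', hm, map_zero, map_zero, map_zero]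
    have hs := IsShortExact.of_injective hfi
    -- If `x t = f m`, then `f'` kills the class of `m`; injectivity of `f'` gives `m = x m'`, and
    -- cancelling `x` gives `t = f m'`.
    have hC : ∀ c : (ι →₀ T) ⧸ LinearMap.range f, (x : Λ) • c = 0 → c = 0 := by
      intro c hc
      obtain ⟨t, rfl⟩ := hs.surjective c
      rw [← map_smul, hs.exact] at hc
      obtain ⟨m, hm⟩ := hc
      obtain ⟨f', hf'⟩ := hj'.isScalarExtension.exists_map
        (Submodule.mkQ _ : (ι →₀ T) →ₗ[Λ] ModMod x (ι →₀ T)) f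
      have : j' m = 0 := by
        refine (hinj' hf').1 ?_
        rw [hf', map_zero, hN'.eq_zero_iff]
        exact ⟨t, hm⟩
      obtain ⟨m', rfl⟩ := (hj'.eq_zero_iff m).mp this
      rw [hs.exact]
      refine ⟨m', ?_⟩
      rw [map_smul, ← sub_eq_zero, ← smul_sub] at hm
      exact sub_eq_zero.mp ((isInAdd_finsupp Λ T ι).smul_eq_zero hx _ hm)
    obtain ⟨f', p', hf', -, h'⟩ := hs.exists_modBy x hj' hN' (isModBy_mkQ x _) hC
    obtain ⟨f'', p'', hf'', -, h''⟩ := hs.exists_locBy x hj'' hN'' (isLocBy_locMk x _)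
    have hfin : Module.Finite Λ ((ι →₀ T) ⧸ LinearMap.range f) := inferInstance
    exact ⟨ModuleCat.of Λ (ι →₀ T), ModuleCat.of Λ ((ι →₀ T) ⧸ LinearMap.range f), f, _, hs,
      -- The approximation property `hf` is exactly the extension condition that makes Ext¹ from the
      -- cokernel to `T` vanish.
      isInAdd_finsupp Λ T ι, ih hfin hC (hs.extVanishes_right hMT (hT.finsupp_left ι) hf)
        (isModBy_mkQ x _) (isLocBy_locMk x _) ((hinj' hf').2 p' h'.exact h'.surjective)
        ((hinj'' hf'').2 p'' h''.exact h''.surjective)⟩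

theorem IsClassicalTilting.of_mod_loc {n : ℕ} (hΛ : ∀ r : Λ, (x : Λ) • r = 0 → r = 0)
    (hx : ∀ t : T, (x : Λ) • t = 0 → t = 0) (hT : StronglyFinitelyPresented Λ T)
    (h' : IsClassicalTilting (RingMod x) (ModMod x T) n)
    (h'' : IsClassicalTilting (RingLoc x) (ModLoc x T) n) : IsClassicalTilting Λ T n := by
  have hj' := isModBy_mkQ x T
  have hj'' := isLocBy_locMk x T
  have hr : HasFiniteResolution Λ n T := hT.hasResolution.hasFiniteResolution_of_mod_loc hΛ hx
    hj' hj'' h'.projectiveDimension_le h''.projectiveDimension_le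
  have := hr.finite
  have hE : ExtVanishes Λ T T := hr.extVanishes_of_mod_loc hx hj' hj''
    ((hr.extVanishes_iff_modBy hΛ hx hj').mpr h'.extVanishes)
    ((hr.extVanishes_iff_locBy hj'').mpr h''.extVanishes)
  obtain ⟨k, hk⟩ := hasAddCoresolution_iff.mp h'.coresolution
  obtain ⟨l, hl⟩ := hasAddCoresolution_iff.mp h''.coresolution
  -- The coresolutions of `Λ/xΛ` and `Λ_x` may differ in length; both are padded to the maximum for
  -- the simultaneous induction.
  exact .of_hasFiniteResolution hr hE (.of_mod_loc hΛ hx hr hE hj' hj'' h'.ext_eq_zero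
    h''.ext_eq_zero inferInstance hΛ .of_projective (isModBy_ring x) (isLocBy_ring x)
    (hk.mono (le_max_left k l)) (hl.mono (le_max_right k l)))

end Coresolution

theorem mainTheorem1 (Λ : Type u) [Ring Λ] (x : Subring.center Λ)
    (T : Type u) [AddCommGroup T] [Module Λ T]
    (hT : StronglyFinitelyPresented Λ T) (hx : IsRegularOn x T) (n : ℕ) :
    (IsClassicalTiltingTriple Λ T n (TiltedRing Λ T) (RingHom.id (TiltedRing Λ T)) →
      IsClassicalTiltingTriple (RingMod x) (ModMod x T) n
        (RingMod (bullet x T)) (tiltedRingModHom x T) ∧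
      IsClassicalTiltingTriple (RingLoc x) (ModLoc x T) n
        (RingLoc (bullet x T)) (tiltedRingLocHom x T)) ∧
    (IsNoetherianRing (Subring.center Λ) → Module.Finite (Subring.center Λ) Λ →
      IsRegularOn x Λ →
      IsClassicalTilting (RingLoc x) (ModLoc x T) n →
      IsClassicalTilting (RingMod x) (ModMod x T) n →
      IsClassicalTilting Λ T n) := by
  refine ⟨fun h => ?_, fun _ _ hΛ h'' h' => .of_mod_loc hΛ.1 hx.1 hT h' h''⟩
  have := hT.hasResolution.finite
  exact ⟨⟨h.isClassicalTilting.modBy x hx.1,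
      tiltedRingModHom_bijective x T hx.1 h.isClassicalTilting.extVanishes⟩,
    ⟨h.isClassicalTilting.locBy x hx.1, tiltedRingLocHom_bijective x T hx.1⟩⟩
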